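/- **Setting.** Let $r\ge 1$ and let $(\bar M,\bar\varphi,\bar\xi_\alpha,\bar\eta^\alpha,\bar g)$, $\alpha=1,\dots,r$, be an indefinite $\mathcal S$-manifold. That is: $\bar g$ is a smooth semi-Riemannian metric of constant index $\nu$, $0<\nu<\dim\bar M$; $\bar\varphi$ is a nowhere zero smooth $(1,1)$-tensor field whose kernel is spanned by the smooth vector fields $\bar\xi_\alpha$; $\bar\eta^\alpha$ are smooth $1$-forms with $\bar\eta^\alpha(\bar\xi_\beta)=\delta^\alpha_\beta$ and $\bar\varphi^2=-I+\sum_\alpha\bar\eta^\alpha\otimes\bar\xi_\alpha$; $\bar g(\bar\varphi X,\bar\varphi Y)=\bar g(X,Y)-\sum_\alpha\varepsilon_\alpha\bar\eta^\alpha(X)\bar\eta^\alpha(Y)$, where $\varepsilon_\alpha=1$ or $-1$ according to whether $\bar\xi_\alpha$ is spacelike or timelike; $N_{\bar\varphi}+2\sum_\alpha d\bar\eta^\alpha\otimes\bar\xi_\alpha=0$, where $N_{\bar\varphi}(X,Y)=[\bar\varphi X,\bar\varphi Y]+\bar\varphi^2[X,Y]-\bar\varphi[\bar\varphi X,Y]-\bar\varphi[X,\bar\varphi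 Y]$; and $d\bar\eta^\alpha(X,Y)=\bar g(X,\bar\varphi Y)$ for every $\alpha$, with the convention $2\,d\eta(X,Y)=X\eta(Y)-Y\eta(X)-\eta([X,Y])$. Let $\bar\nabla$ be the Levi-Civita connection of $\bar g$. Let $M$ be a characteristic lightlike hypersurface of $\bar M$: an immersed hypersurface, identified locally with its image, such that the induced metric is degenerate at every point, so that $\mathrm{Rad}(T_pM)=T_pM\cap T_pM^{\perp}\neq 0$, and such that all $\bar\xi_\alpha$ are tangent to $M$. Let $S(TM)$ be a characteristic screen distribution: a smooth distribution with $TM=\mathrm{Rad}(TM)\oplus S(TM)$, $\ker\bar\varphi\subset S(TM)$ and $\bar\varphi(\mathrm{Rad}(TM))\subset S(TM)$. Let $\mathrm{ltr}(M)\subset T\bar M|_M$ be the line bundle spanned at $p$ by the vectors $n$ with $\bar g(n,n)=0$, $\bar g(n,w)=0$ for all $w\in S(T_pM)$, and $\bar g(n,e)=1$ for some $e\in\mathrm{Rad}(T_pM)$; then $T\bar M|_M=TM\oplus\mathrm{ltr}(M)$. For vector fields $X,Y$ on $M$ let $h(X,Y)$ be the $\mathrm{ltr}(M)$-component of $\bar\nabla_XY$.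 Let $D_0$ be the orthogonal complement of $\bar\varphi(\mathrm{Rad}(TM))\oplus\bar\varphi(\mathrm{ltr}(M))$ in $S(TM)$, and let $$D=D_0\perp\bar\varphi(\mathrm{Rad}(TM))\perp\mathrm{Rad}(TM)\subset TM .$$ Let $M$ be covered by open sets $U_i$, each carrying a nowhere vanishing smooth section $E_i$ of $\mathrm{Rad}(TM)$ (a single set $U=M$ if $\mathrm{Rad}(TM)$ has a global nowhere vanishing section $E$). On $U_i$ put $B_i(X,Y)=\bar g(h(X,Y),E_i)$ (the local second fundamental form) and $V_i=-\bar\varphi E_i$. **Proposition.** The distribution $D$ is integrable (the Lie bracket of any two smooth local sections of $D$ is a section of $D$) if and only if for every $i$ the following three conditions hold on $U_i$: a) $B_i(X,\bar\varphi Y)=B_i(\bar\varphi X,Y)$ for all $X,Y\in\Gamma(D_0|_{U_i})$; b) $B_i(X,V_i)=0$ for all $X\in\Gamma(D_0|_{U_i})$; c) $B_i(V_i,V_i)=0$. -/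

import Mathlib

open scoped Manifold ContDiff Topology

noncomputable section

namespace LightlikeGeometry

section Ambient

variable {F : Type*} [NormedAddCommGroup F] [NormedSpace ℝ F]
  {G : Type*} [TopologicalSpace G] (J : ModelWithCorners ℝ F G)
  (N : Type*) [TopologicalSpace N] [ChartedSpace G N] [IsManifold J ∞ N]

/-- A smooth semi-Riemannian metric: a smooth symmetric nondegenerate `(0,2)`-tensor field whose
index (the largest dimension of a negative definite subspace of a tangent space) is constant. -/
structure SemiRiemannianMetric where
  inner (x : N) : TangentSpace J x →L[ℝ] TangentSpace J x →L[ℝ] ℝ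
  symm : ∀ (x : N) (v w : TangentSpace J x), inner x v w = inner x w v
  nondegenerate : ∀ (x : N) (v : TangentSpace J x), (∀ w, inner x v w = 0) → v = 0
  contMDiff : ContMDiff J (J.prod 𝓘(ℝ, F →L[ℝ] F →L[ℝ] ℝ)) ∞
    (fun x => Bundle.TotalSpace.mk' (F →L[ℝ] F →L[ℝ] ℝ) x (inner x))
  index : ℕ
  isGreatest_index : ∀ x : N,
    IsGreatest {k | ∃ W : Submodule ℝ (TangentSpace J x),
      Module.finrank ℝ W = k ∧ ∀ w ∈ W, w ≠ 0 → inner x w w < 0} index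

variable {N}

/-- `X` is a smooth vector field on the set `U`. -/
def IsSmoothFieldOn (X : Π x : N, TangentSpace J x) (U : Set N) : Prop :=
  ContMDiffOn J J.tangent ∞ (fun x => (⟨x, X x⟩ : TangentBundle J N)) U

/-- A smooth distribution of constant rank: locally spanned by a smooth frame. -/
def IsSmoothDistribution (D : Π x : N, Submodule ℝ (TangentSpace J x)) : Prop :=
  ∃ k : ℕ, ∀ x : N, ∃ U : Set N, IsOpen U ∧ x ∈ U ∧
    ∃ s : Fin k → Π y : N, TangentSpace J y, (∀ i, IsSmoothFieldOn J (s i) U) ∧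
      ∀ y ∈ U, LinearIndependent ℝ (fun i => s i y) ∧
        Submodule.span ℝ (Set.range fun i => s i y) = D y

/-- Integrability of a distribution: the Lie bracket of two (local) smooth sections of `D` is again
a section of `D`. -/
def IsIntegrable (D : Π x : N, Submodule ℝ (TangentSpace J x)) : Prop :=
  ∀ (W : Set N), IsOpen W → ∀ X Y : Π x : N, TangentSpace J x,
    IsSmoothFieldOn J X W → IsSmoothFieldOn J Y W →
    (∀ x ∈ W, X x ∈ D x) → (∀ x ∈ W, Y x ∈ D x) →
    ∀ x ∈ W, VectorField.mlieBracket J X Y x ∈ D x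

variable {J}

/-- `∇` is the Levi-Civita connection of `g`: it is torsion-free and `∇ g = 0`. -/
structure IsLeviCivita [FiniteDimensional ℝ F] (g : SemiRiemannianMetric J N)
    (cov : CovariantDerivative J F (TangentSpace J : N → Type _)) : Prop where
  torsion_free : ∀ (X Y : Π x : N, TangentSpace J x) (x : N),
    MDiffAt (T% X) x → MDiffAt (T% Y) x →
      cov Y x (X x) - cov X x (Y x) = VectorField.mlieBracket J X Y x
  metric : ∀ (Y Z : Π x : N, TangentSpace J x) (x : N) (v : TangentSpace J x),
    MDiffAt (T% Y) x → MDiffAt (T% Z) x →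
      mvfderiv J (fun y => g.inner y (Y y) (Z y)) x v
        = g.inner x (cov Y x v) (Z x) + g.inner x (Y x) (cov Z x v)

variable (J N)

/-- An indefinite metric globally framed `f`-manifold structure
`(φ, ξ_α, η^α, g)`, `α = 1, …, r`, on `N`. -/
structure IndefiniteMetricGFF (r : ℕ) where
  metric : SemiRiemannianMetric J N
  index_pos : 0 < metric.index
  index_lt : metric.index < Module.finrank ℝ F
  φ (x : N) : TangentSpace J x →L[ℝ] TangentSpace J x
  φ_smooth : ContMDiff J (J.prod 𝓘(ℝ, F →L[ℝ] F)) ∞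
    (fun x => Bundle.TotalSpace.mk' (F →L[ℝ] F)
      (E := fun x : N => TangentSpace J x →L[ℝ] TangentSpace J x) x (φ x))
  φ_ne_zero : ∀ x, φ x ≠ 0
  ξ : Fin r → Π x : N, TangentSpace J x
  ξ_smooth : ∀ α, IsSmoothFieldOn J (ξ α) Set.univ
  η : Fin r → Π x : N, TangentSpace J x →L[ℝ] ℝ
  η_smooth : ∀ α, ContMDiff J (J.prod 𝓘(ℝ, F →L[ℝ] ℝ)) ∞
    (fun x => Bundle.TotalSpace.mk' (F →L[ℝ] ℝ)
      (E := fun x : N => TangentSpace J x →L[ℝ] ℝ) x (η α x))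
  ker_φ : ∀ x, LinearMap.ker (φ x : TangentSpace J x →ₗ[ℝ] TangentSpace J x)
    = Submodule.span ℝ (Set.range fun α => ξ α x)
  φ_sq : ∀ x v, φ x (φ x v) = -v + ∑ α, η α x v • ξ α x
  η_ξ : ∀ x α β, η α x (ξ β x) = if α = β then 1 else 0
  ε : Fin r → ℝ
  ε_eq : ∀ x α, (0 < metric.inner x (ξ α x) (ξ α x) ∧ ε α = 1) ∨
    (metric.inner x (ξ α x) (ξ α x) < 0 ∧ ε α = -1)
  compatible : ∀ x v w, metric.inner x (φ x v) (φ x w)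
    = metric.inner x v w - ∑ α, ε α * η α x v * η α x w

variable {J N}

/-- Exterior derivative of a `1`-form, with the convention
`2 dη(X,Y) = X(η(Y)) - Y(η(X)) - η([X,Y])`. -/
def extDeriv (η : Π x : N, TangentSpace J x →L[ℝ] ℝ) (X Y : Π x : N, TangentSpace J x) (x : N) :
    ℝ :=
  (1 / 2 : ℝ) * (mvfderiv J (fun y => η y (Y y)) x (X x) - mvfderiv J (fun y => η y (X y)) x (Y x)
    - η x (VectorField.mlieBracket J X Y x))

/-- Nijenhuis torsion `[φX,φY] + φ²[X,Y] - φ[φX,Y] - φ[X,φY]`. -/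
def nijenhuis (φ : Π x : N, TangentSpace J x →L[ℝ] TangentSpace J x)
    (X Y : Π x : N, TangentSpace J x) (x : N) : TangentSpace J x :=
  VectorField.mlieBracket J (fun y => φ y (X y)) (fun y => φ y (Y y)) x
    + φ x (φ x (VectorField.mlieBracket J X Y x))
    - φ x (VectorField.mlieBracket J (fun y => φ y (X y)) Y x)
    - φ x (VectorField.mlieBracket J X (fun y => φ y (Y y)) x)

/-- Indefinite `𝒮`-manifold: normal, and `dη^α = Φ` for all `α`, where `Φ(X,Y) = g(X, φY)`. -/
structure IndefiniteMetricGFF.IsSManifold {r : ℕ} (s : IndefiniteMetricGFF J N r) : Prop where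
  normal : ∀ X Y : Π x : N, TangentSpace J x,
    IsSmoothFieldOn J X Set.univ → IsSmoothFieldOn J Y Set.univ →
    ∀ x, nijenhuis s.φ X Y x + ∑ α, (2 * extDeriv (s.η α) X Y x) • s.ξ α x = 0
  dη_eq : ∀ (α : Fin r) (X Y : Π x : N, TangentSpace J x),
    IsSmoothFieldOn J X Set.univ → IsSmoothFieldOn J Y Set.univ →
    ∀ x, extDeriv (s.η α) X Y x = s.metric.inner x (X x) (s.φ x (Y x))

end Ambient

section Hypersurface

variable {E : Type*} [NormedAddCommGroup E] [NormedSpace ℝ E]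
  {H : Type*} [TopologicalSpace H] (I : ModelWithCorners ℝ E H)
  {M : Type*} [TopologicalSpace M] [ChartedSpace H M]
  {F : Type*} [NormedAddCommGroup F] [NormedSpace ℝ F]
  {G : Type*} [TopologicalSpace G] {J : ModelWithCorners ℝ F G}
  {N : Type*} [TopologicalSpace N] [ChartedSpace G N] [IsManifold J ∞ N]

variable (J) in
/-- The tangent space `T_p M`, regarded as the subspace `df_p(T_p M)` of `T_{f p} N`. -/
def tangentImage (f : M → N) (p : M) : Submodule ℝ (TangentSpace J (f p)) :=
  LinearMap.range (mfderiv I J f p : TangentSpace I p →ₗ[ℝ] TangentSpace J (f p))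

/-- The image in `T_{f p} N` of a subspace of `T_p M`. -/
def push (f : M → N) (p : M) (W : Submodule ℝ (TangentSpace I p)) :
    Submodule ℝ (TangentSpace J (f p)) :=
  W.map (mfderiv I J f p : TangentSpace I p →ₗ[ℝ] TangentSpace J (f p))

/-- For `w` in the image of the (injective) differential `df_p`, the vector `v ∈ T_p M` with
`df_p v = w`. -/
def pull (f : M → N) (p : M) (w : TangentSpace J (f p)) : TangentSpace I p :=
  Function.invFun (mfderiv I J f p) w

/-- The radical `Rad(T_p M)` of the induced (possibly degenerate) metric on `M`. -/
def radical (g : SemiRiemannianMetric J N) (f : M → N) (p : M) :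
    Submodule ℝ (TangentSpace I p) where
  carrier := {v | ∀ w : TangentSpace I p,
    g.inner (f p) (mfderiv I J f p v) (mfderiv I J f p w) = 0}
  add_mem' := by
    intro a b ha hb w
    have h1 := ha w
    have h2 := hb w
    simp [h1, h2]
  zero_mem' := by intro w; simp
  smul_mem' := by
    intro c a ha w
    have h1 := ha w
    simp [h1]

/-- `f : M → N` is an (immersed) lightlike hypersurface of the semi-Riemannian manifold `(N, g)`:
an immersion of codimension one such that the induced metric is degenerate at every point. -/
structure IsLightlikeHypersurface (g : SemiRiemannianMetric J N) (f : M → N) : Prop where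
  codim_one : Module.finrank ℝ F = Module.finrank ℝ E + 1
  smooth : ContMDiff I J ∞ f
  injective_mfderiv : ∀ p, Function.Injective (mfderiv I J f p)
  degenerate : ∀ p, radical I g f p ≠ ⊥

/-- A screen distribution: a smooth distribution on `M` complementary to the radical one. -/
structure IsScreen [IsManifold I ∞ M] (g : SemiRiemannianMetric J N) (f : M → N)
    (S : Π p : M, Submodule ℝ (TangentSpace I p)) : Prop where
  smooth : IsSmoothDistribution I S
  isCompl : ∀ p, IsCompl (radical I g f p) (S p)

/-- The lightlike transversal bundle `ltr(M)` determined by the screen distribution `S`: its fibre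
at `p` is spanned by the vectors `n` with `g(n,e) = 1` for some `e ∈ Rad(T_p M)`, `g(n,n) = 0` and
`g(n,w) = 0` for all `w ∈ S`. -/
def ltr (g : SemiRiemannianMetric J N) (f : M → N)
    (S : Π p : M, Submodule ℝ (TangentSpace I p)) (p : M) :
    Submodule ℝ (TangentSpace J (f p)) :=
  Submodule.span ℝ {n | (∃ e ∈ radical I g f p, g.inner (f p) n (mfderiv I J f p e) = 1) ∧
    g.inner (f p) n n = 0 ∧ ∀ w ∈ S p, g.inner (f p) n (mfderiv I J f p w) = 0}

/-- `T_{f p} N = T_p M ⊕ ltr(M)_p` along a lightlike hypersurface with a screen distribution; hence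
`ltrComponent` below is always given by its first branch. -/
theorem isCompl_ltr_tangentImage {E : Type*} [NormedAddCommGroup E] [NormedSpace ℝ E]
    {H : Type*} [TopologicalSpace H] (I : ModelWithCorners ℝ E H)
    {M : Type*} [TopologicalSpace M] [ChartedSpace H M] [IsManifold I ∞ M]
    {F : Type*} [NormedAddCommGroup F] [NormedSpace ℝ F] [FiniteDimensional ℝ F]
    {G : Type*} [TopologicalSpace G] {J : ModelWithCorners ℝ F G}
    {N : Type*} [TopologicalSpace N] [ChartedSpace G N] [IsManifold J ∞ N]
    {g : SemiRiemannianMetric J N} {f : M → N} (hf : IsLightlikeHypersurface I g f)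
    {S : Π p : M, Submodule ℝ (TangentSpace I p)} (hS : IsScreen I g f S) (p : M) :
    IsCompl (ltr I g f S p) (tangentImage I J f p) := by
  have : FiniteDimensional ℝ (TangentSpace J (f p)) := inferInstanceAs (FiniteDimensional ℝ F)
  set T := tangentImage I J f p with hT
  obtain ⟨e, he, he0⟩ := Submodule.exists_mem_ne_zero_of_ne_bot (hf.degenerate p)
  set d : TangentSpace I p →ₗ[ℝ] TangentSpace J (f p) := (mfderiv I J f p).toLinearMap with hd
  have hinj : Function.Injective d := hf.injective_mfderiv p
  let b : TangentSpace J (f p) →ₗ[ℝ] TangentSpace J (f p) →ₗ[ℝ] ℝ :=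
    { toFun := fun v => (g.inner (f p) v : TangentSpace J (f p) →ₗ[ℝ] ℝ)
      map_add' := by intro x y; ext; simp
      map_smul' := by intro x y; ext; simp }
  have hb : ∀ v w, b v w = g.inner (f p) v w := fun _ _ => rfl
  have hbinj : Function.Injective b := by
    rw [← LinearMap.ker_eq_bot, LinearMap.ker_eq_bot']
    intro v hv
    exact g.nondegenerate _ v fun w => by rw [← hb, hv]; rfl
  have hbsurj : Function.Surjective b := by
    have := LinearMap.injective_iff_surjective_of_finrank_eq_finrank (f := b)
      (by rw [Subspace.dual_finrank_eq])
    exact this.1 hbinj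
  have hTrank : Module.finrank ℝ T + 1 = Module.finrank ℝ (TangentSpace J (f p)) := by
    have h1 : Module.finrank ℝ T = Module.finrank ℝ E := LinearMap.finrank_range_of_inj hinj
    have h2 : Module.finrank ℝ (TangentSpace J (f p)) = Module.finrank ℝ F := rfl
    rw [h1, h2, hf.codim_one]
  have heT : ∀ w ∈ T, b (d e) w = 0 := by
    rintro _ ⟨w, rfl⟩
    exact he w
  have hde0 : d e ≠ 0 := fun h => he0 (hinj (by simpa using h))
  -- `T` is the orthogonal complement of `e`
  have hTker : T = LinearMap.ker (b (d e)) := by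
    apply Submodule.eq_of_le_of_finrank_eq
    · intro w hw; exact heT w hw
    · have h1 := LinearMap.finrank_range_add_finrank_ker (b (d e))
      have h2 : b (d e) ≠ 0 := fun h => hde0 (hbinj (by simpa using h))
      have h3 : Module.finrank ℝ (LinearMap.range (b (d e))) = 1 := by
        rw [LinearMap.range_eq_top.2 (LinearMap.surjective h2)]
        simp
      omega
  -- a functional on `T_p M` with value `1` at `e` and `0` on the screen
  have hdis : e ∉ S p := fun h => he0 (by
    have := (hS.isCompl p).disjoint
    exact (Submodule.disjoint_def.1 this) e he h)
  obtain ⟨l, hl0, hlS⟩ := Submodule.exists_le_ker_of_notMem hdis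
  obtain ⟨dinv, hdinv⟩ := d.exists_leftInverse_of_injective (LinearMap.ker_eq_bot.2 hinj)
  obtain ⟨n₀, hn₀⟩ := hbsurj ((l e)⁻¹ • (l ∘ₗ dinv))
  have hn₀d : ∀ v, b n₀ (d v) = (l e)⁻¹ * l v := by
    intro v
    have : dinv (d v) = v := LinearMap.congr_fun hdinv v
    rw [hn₀]; simp [this]
  have hsymm : ∀ v w, b v w = b w v := fun v w => g.symm _ v w
  let n := n₀ - (b n₀ n₀ / 2) • d e
  have hne : b n (d e) = 1 := by
    have := heT (d e) ⟨e, rfl⟩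
    simp [n, hn₀d, this, hl0]
  have hnn : b n n = 0 := by
    have h1 := heT (d e) ⟨e, rfl⟩
    have h2 : b n₀ (d e) = 1 := by simp [hn₀d, hl0]
    have h3 : b (d e) n₀ = 1 := by rw [hsymm, h2]
    simp [n, h1, h2, h3]
    ring
  have hnS : ∀ w ∈ S p, b n (d w) = 0 := by
    intro w hw
    have h1 := heT (d w) ⟨w, rfl⟩
    have h2 : l w = 0 := hlS hw
    simp [n, hn₀d, h1, h2]
  have hmem : n ∈ ltr I g f S p := Submodule.subset_span ⟨⟨e, he, hne⟩, hnn, hnS⟩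
  have hen : b (d e) n = 1 := by rw [hsymm, hne]
  have hperp : ∀ u, (∀ w ∈ T, b u w = 0) → u = b u n • d e := by
    intro u hu
    apply hbinj
    ext w
    have hw : w - b (d e) w • n ∈ T := by
      rw [hTker, LinearMap.mem_ker]; simp [hen]
    have := hu _ hw
    simp only [map_sub, map_smul, smul_eq_mul] at this
    simp only [map_smul, LinearMap.smul_apply, smul_eq_mul]
    linarith
  have hle : ltr I g f S p ≤ Submodule.span ℝ {n} := by
    refine Submodule.span_le.2 ?_
    rintro n' ⟨⟨e', he', hn'e'⟩, hn'n', hn'S⟩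
    change b n' (d e') = 1 at hn'e'
    change b n' n' = 0 at hn'n'
    have hn'S' : ∀ w ∈ S p, b n' (d w) = 0 := hn'S
    have hrad : ∀ x ∈ radical I g f p, d x = b (d x) n • d e := by
      intro x hx
      refine hperp _ ?_
      rintro _ ⟨w, rfl⟩
      exact hx w
    have ha : b n' (d e) ≠ 0 := by
      intro h
      rw [hrad e' he', map_smul, h, smul_zero] at hn'e'
      exact zero_ne_one hn'e'
    have hdec := hperp (n' - b n' (d e) • n) (by
      rintro _ ⟨w, rfl⟩
      have hw : w ∈ radical I g f p ⊔ S p := by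
        rw [(hS.isCompl p).sup_eq_top]; trivial
      obtain ⟨x, hx, y, hy, rfl⟩ := Submodule.mem_sup.1 hw
      change b (n' - b n' (d e) • n) (d (x + y)) = 0
      rw [map_add, hrad x hx]
      simp [hne, hn'S' y hy, hnS y hy]
      ring)
    set y := b (n' - b n' (d e) • n) n with hy
    set a := b n' (d e) with ha'
    have hn' : n' = a • n + y • d e := by rw [← hdec]; abel
    have h1 := heT (d e) ⟨e, rfl⟩
    rw [hn'] at hn'n'
    simp [hnn, hne, hen, h1] at hn'n'
    have hy0 : y = 0 := by
      have : a * y = 0 := by linarith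
      exact (mul_eq_zero.1 this).resolve_left ha
    rw [hn', hy0]
    exact Submodule.mem_span_singleton.2 ⟨a, by simp⟩
  refine IsCompl.of_eq ?_ ?_
  · rw [eq_bot_iff]
    rintro x ⟨hx, hxT⟩
    obtain ⟨a, rfl⟩ := Submodule.mem_span_singleton.1 (hle hx)
    have h := heT _ hxT
    simp [hen] at h
    simp [h]
  · rw [eq_top_iff]
    intro w _
    have hw : w - b (d e) w • n ∈ T := by
      rw [hTker, LinearMap.mem_ker]; simp [hen]
    rw [show w = b (d e) w • n + (w - b (d e) w • n) by abel]
    exact Submodule.add_mem_sup (Submodule.smul_mem _ _ hmem) hw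

open Classical in
/-- The component of `w ∈ T_{f p} N` along `ltr(M)` in the decomposition
`T_{f p} N = T_p M ⊕ ltr(M)_p` (see `isCompl_ltr_tangentImage`). -/
def ltrComponent (g : SemiRiemannianMetric J N) (f : M → N)
    (S : Π p : M, Submodule ℝ (TangentSpace I p)) (p : M) (w : TangentSpace J (f p)) :
    TangentSpace J (f p) :=
  if h : IsCompl (ltr I g f S p) (tangentImage I J f p) then
    Submodule.projection _ _ h w else 0

/-- The connection induced by `∇` on vector fields along `f` (the pullback connection on
`f^* TN`): if `Z = ∑ Z^i ∂_i ∘ f` in the local frame `∂_i` of `TN` given by the trivialization at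
`f p`, then `∇_v Z = ∑ dZ^i(v) ∂_i + ∑ Z^i(p) ∇_{df v} ∂_i`. -/
def covAlong (cov : CovariantDerivative J F (TangentSpace J : N → Type _)) (f : M → N)
    (Z : Π p : M, TangentSpace J (f p)) (p : M) (v : TangentSpace I p) : TangentSpace J (f p) :=
  letI t := trivializationAt F (TangentSpace J : N → Type _) (f p)
  t.symm (f p) (mvfderiv I (fun q => (t ⟨f q, Z q⟩).2) p v)
    + cov (fun y => t.symm y (t ⟨f p, Z p⟩).2) (f p) (mfderiv I J f p v)

/-- The second fundamental form `h(X,Y)`: the component along `ltr(M)` of `∇_X Y`, for vector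
fields `X`, `Y` on `M`. -/
def secondFundamentalForm (g : SemiRiemannianMetric J N)
    (cov : CovariantDerivative J F (TangentSpace J : N → Type _)) (f : M → N)
    (S : Π p : M, Submodule ℝ (TangentSpace I p)) (X Y : Π p : M, TangentSpace I p) (p : M) :
    TangentSpace J (f p) :=
  ltrComponent I g f S p (covAlong I cov f (fun q => mfderiv I J f q (Y q)) p (X p))

/-- The local second fundamental form `B(X,Y) = g(h(X,Y), e)` with respect to the section `e` of
`Rad(TM)`. -/
def localSecondFundamentalForm (g : SemiRiemannianMetric J N)
    (cov : CovariantDerivative J F (TangentSpace J : N → Type _)) (f : M → N)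
    (S : Π p : M, Submodule ℝ (TangentSpace I p)) (e : Π p : M, TangentSpace I p)
    (X Y : Π p : M, TangentSpace I p) (p : M) : ℝ :=
  g.inner (f p) (secondFundamentalForm I g cov f S X Y p) (mfderiv I J f p (e p))

/-- The image under `φ` of a subspace of `T_x N`. -/
def phiImage {r : ℕ} (s : IndefiniteMetricGFF J N r) {x : N}
    (W : Submodule ℝ (TangentSpace J x)) : Submodule ℝ (TangentSpace J x) :=
  W.map (s.φ x : TangentSpace J x →ₗ[ℝ] TangentSpace J x)

/-- The lightlike hypersurface is characteristic, i.e. all `ξ_α` are tangent to `M`, and so is the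
screen distribution, i.e. `ker φ ⊆ S` and `φ(Rad TM) ⊆ S`. -/
structure IsCharacteristic {r : ℕ} (s : IndefiniteMetricGFF J N r) (f : M → N)
    (S : Π p : M, Submodule ℝ (TangentSpace I p)) : Prop where
  ξ_tangent : ∀ p α, s.ξ α (f p) ∈ tangentImage I J f p
  ker_le : ∀ p, LinearMap.ker (s.φ (f p) : TangentSpace J (f p) →ₗ[ℝ] TangentSpace J (f p))
    ≤ push I f p (S p)
  phi_radical_le : ∀ p, phiImage s (push I f p (radical I s.metric f p)) ≤ push I f p (S p)

/-- The vector field `φX` on `M`, for a vector field `X` on `M` such that `φX` is tangent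
to `M`. -/
def phiField {r : ℕ} (s : IndefiniteMetricGFF J N r) (f : M → N)
    (X : Π p : M, TangentSpace I p) (p : M) : TangentSpace I p :=
  pull I f p (s.φ (f p) (mfderiv I J f p (X p)))

/-- The distribution `D₀` on `M`: the orthogonal complement of `φ(Rad TM) ⊕ φ(ltr M)` in the
screen distribution `S`. -/
def distD₀ {r : ℕ} (s : IndefiniteMetricGFF J N r) (f : M → N)
    (S : Π p : M, Submodule ℝ (TangentSpace I p)) (p : M) : Submodule ℝ (TangentSpace I p) where
  carrier := {v | v ∈ S p ∧ ∀ z ∈ phiImage s (push I f p (radical I s.metric f p)) ⊔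
    phiImage s (ltr I s.metric f S p), s.metric.inner (f p) (mfderiv I J f p v) z = 0}
  add_mem' := by
    rintro a b ⟨ha, ha'⟩ ⟨hb, hb'⟩
    refine ⟨add_mem ha hb, fun z hz => ?_⟩
    simp [ha' z hz, hb' z hz]
  zero_mem' := ⟨zero_mem _, fun z _ => by simp⟩
  smul_mem' := by
    rintro c a ⟨ha, ha'⟩
    refine ⟨Submodule.smul_mem _ c ha, fun z hz => ?_⟩
    simp [ha' z hz]

/-- The distribution `D = D₀ ⊥ φ(Rad TM) ⊥ Rad TM` on `M`; here `φ(Rad TM)`, a subspace of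
`T_{f p} N` contained in the image of `df_p`, is regarded as a subspace of `T_p M`. -/
def distD {r : ℕ} (s : IndefiniteMetricGFF J N r) (f : M → N)
    (S : Π p : M, Submodule ℝ (TangentSpace I p)) (p : M) : Submodule ℝ (TangentSpace I p) :=
  distD₀ I s f S p ⊔
    (phiImage s (push I f p (radical I s.metric f p))).comap
      (mfderiv I J f p : TangentSpace I p →ₗ[ℝ] TangentSpace J (f p)) ⊔
    radical I s.metric f p

end Hypersurface

end LightlikeGeometry

end

open scoped Bundle
open VectorField

noncomputable section

set_option linter.unusedSectionVars false

namespace LightlikeGeometry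

section

variable {E : Type*} [NormedAddCommGroup E] [NormedSpace ℝ E] [FiniteDimensional ℝ E]
  {H : Type*} [TopologicalSpace H] {I : ModelWithCorners ℝ E H} [I.Boundaryless]
  {M : Type*} [TopologicalSpace M] [ChartedSpace H M] [IsManifold I ∞ M]
  {F : Type*} [NormedAddCommGroup F] [NormedSpace ℝ F] [FiniteDimensional ℝ F]
  {G : Type*} [TopologicalSpace G] {J : ModelWithCorners ℝ F G} [J.Boundaryless]
  {N : Type*} [TopologicalSpace N] [ChartedSpace G N] [IsManifold J ∞ N]

/-! Locally `D` is the kernel on `TM` of the 1-form `g(·, φE)` (`mem_distD_iff`), so it is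
integrable exactly when `g([X, Y], φE) = 0` for all sections `X, Y` of `D`.

The core is the identity `g([X, Y], φE) = B(Y, φX) - B(X, φY)` for such sections
(`inner_mfderiv_mlieBracket`). Indeed `g([X, Y], φE) = -g(φ∇_X Y - φ∇_Y X, E)`, and `g(φ∇_X Y, E) =
g(∇_X(φY), E) - g((∇_X φ)Y, E)`, whose first term is `B(X, φY)`. Write `T(u, v, w) = g((∇_u φ)v,
w)`. The error `T(X, Y, E) - T(Y, X, E)` equals `-T(E, X, Y)`, because `Φ = dη` is closed
(`nablaPhi_cyclic`). This vanishes because `E` is orthogonal to `TM` and to every `ξ_α`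
(`nablaPhi_eq_zero`, which combines closedness, normality and the compatibility of `φ` with `g`).

The form `B(x, y) = -g(∇_x E, y)` is pointwise bilinear, symmetric and zero whenever one argument is
`E` (`radForm`). Integrability thus means `B(x, φy) = B(y, φx)` on `D`. Decompose `D` into `D₀`, `V`
and `E`, with `φ D₀ ⊆ D₀`, `φV = E` and `φE = -V`. The pairs (`D₀`, `D₀`), (`D₀`, `E`) and (`V`,
`E`) give conditions a), b) and c), and by bilinearity these suffice. To pass from fields to
vectors, every vector of `D₀` must extend to a smooth section of `D₀`
(`exists_smooth_extension_distD₀`). -/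

/-! ### Lie brackets as commutators of derivations. -/

theorem isManifold_minSmoothness_three (I : ModelWithCorners ℝ E H) (M : Type*)
    [TopologicalSpace M] [ChartedSpace H M] [IsManifold I ∞ M] :
    IsManifold I (minSmoothness ℝ 3) M := by
  rw [minSmoothness_of_isRCLikeNormedField]; infer_instance

/-- Lie brackets act on functions as commutators of derivations. -/
theorem mvfderiv_mlieBracket {u : M → F} {X Y : Π x : M, TangentSpace I x} {x : M}
    (hu : ContMDiffAt I 𝓘(ℝ, F) 2 u x) (hX : MDiffAt (T% X) x) (hY : MDiffAt (T% Y) x) :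
    mvfderiv I u x (mlieBracket I X Y x)
      = mvfderiv I (fun y => mvfderiv I u y (Y y)) x (X x)
        - mvfderiv I (fun y => mvfderiv I u y (X y)) x (Y x) := by
  have := isManifold_minSmoothness_three I M
  set e := extChartAt I x with he
  set û : E → F := u ∘ e.symm with hû
  -- `P Z` is `Z` read in the chart at `x`; the identity is proved for these fields on the model
  -- space.
  set P : (Π x : M, TangentSpace I x) → E → E := fun Z => mpullback 𝓘(ℝ, E) I e.symm Z with hP
  have hsym : ContMDiffAt 𝓘(ℝ, E) I 2 e.symm (e x) :=
    (contMDiffOn_extChartAt_symm x).contMDiffAt (extChartAt_target_mem_nhds x)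
  have hxx : e.symm (e x) = x := extChartAt_to_inv x
  have hûd : ContDiffAt ℝ 2 û (e x) := by
    rw [← contMDiffAt_iff_contDiffAt]
    exact ContMDiffAt.comp_of_eq hu hsym hxx
  have hPd : ∀ Z : Π x : M, TangentSpace I x, MDiffAt (T% Z) x →
      DifferentiableAt ℝ (P Z) (e x) := by
    intro Z hZ
    have := (mdifferentiableWithinAt_univ.2 hZ).differentiableWithinAt_mpullbackWithin_vectorField
    rw [I.range_eq_univ, mpullbackWithin_univ] at this
    simp only [Set.preimage_univ, Set.inter_univ] at this
    exact differentiableWithinAt_univ.1 this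
  have hinv : ∀ z ∈ e.target, (mfderiv 𝓘(ℝ, E) I e.symm z).IsInvertible := by
    intro z hz
    have := isInvertible_mfderivWithin_extChartAt_symm (I := I) hz
    rwa [I.range_eq_univ, mfderivWithin_univ] at this
  have hPz : ∀ z ∈ e.target, ∀ Z : Π x : M, TangentSpace I x,
      mfderiv 𝓘(ℝ, E) I e.symm z (P Z z) = Z (e.symm z) := by
    intro z hz Z
    obtain ⟨A, hA⟩ := hinv z hz
    change mfderiv 𝓘(ℝ, E) I e.symm z ((mfderiv 𝓘(ℝ, E) I e.symm z).inverse _) = _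
    rw [← hA, ContinuousLinearMap.inverse_equiv]
    exact A.apply_symm_apply _
  -- The point `y` is kept apart from `e.symm z` so that the formula applies at `x`, which equals
  -- `e.symm (e x)` only propositionally.
  have hchart' : ∀ (h : M → F), ∀ z ∈ e.target, ∀ y, y = e.symm z → MDiffAt h y →
      ∀ Z : Π x : M, TangentSpace I x,
      mvfderiv I h y (Z y) = fderiv ℝ (h ∘ e.symm) z (P Z z) := by
    rintro h z hz y rfl hh Z
    rw [← hPz z hz Z, ← mfderiv_eq_fderiv]
    have h2 : MDiffAt e.symm z :=
      ((contMDiffOn_extChartAt_symm (n := 2) x).contMDiffAt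
        ((isOpen_extChartAt_target x).mem_nhds hz)).mdifferentiableAt two_ne_zero
    rw [mfderiv_comp z hh h2]
    rfl
  have hexm : e x ∈ e.target := mem_extChartAt_target x
  have hcomm : ∀ X Y : Π x : M, TangentSpace I x, MDiffAt (T% X) x → MDiffAt (T% Y) x →
      mvfderiv I (fun y => mvfderiv I u y (Y y)) x (X x)
        = fderiv ℝ (fun z => fderiv ℝ û z (P Y z)) (e x) (P X (e x)) := by
    intro X Y hX hY
    have hev : (fun y => mvfderiv I u y (Y y)) ∘ e.symm
        =ᶠ[𝓝 (e x)] fun z => fderiv ℝ û z (P Y z) := by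
      have h1 : ∀ᶠ y in 𝓝 (e.symm (e x)), ContMDiffAt I 𝓘(ℝ, F) 2 u y := by
        rw [hxx]
        exact (contMDiffAt_iff_contMDiffAt_nhds (by simp)).1 hu
      filter_upwards [extChartAt_target_mem_nhds x,
        (continuousAt_extChartAt_symm x).eventually h1] with z hz hz1
      exact hchart' u z hz _ rfl (hz1.mdifferentiableAt two_ne_zero) Y
    have hdiff : DifferentiableAt ℝ (fun z => fderiv ℝ û z (P Y z)) (e x) :=
      ((hûd.fderiv_right (m := 1) (by norm_num)).differentiableAt one_ne_zero).clm_apply (hPd Y hY)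
    have hmd : MDiffAt (fun y => mvfderiv I u y (Y y)) x := by
      have h2 : MDiffAt ((fun z => fderiv ℝ û z (P Y z)) ∘ e) x :=
        hdiff.mdifferentiableAt.comp x (mdifferentiableAt_extChartAt (mem_chart_source H x))
      refine h2.congr_of_eventuallyEq ?_
      have hc : ContinuousAt e x := continuousAt_extChartAt x
      filter_upwards [hc.eventually hev, extChartAt_source_mem_nhds (I := I) x] with y hy hys
      rw [Function.comp_apply, ← hy, Function.comp_apply, e.left_inv hys]
    rw [hchart' _ (e x) hexm x hxx.symm hmd X, hev.fderiv_eq]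
  rw [hcomm X Y hX hY, hcomm Y X hY hX,
    hchart' u (e x) hexm x hxx.symm (hu.mdifferentiableAt two_ne_zero) (mlieBracket I X Y)]
  have hb : P (mlieBracket I X Y) (e x) = lieBracket ℝ (P X) (P Y) (e x) := by
    have := mpullback_mlieBracket (I := 𝓘(ℝ, E)) (I' := I) (f := e.symm) (x₀ := e x) (n := 2)
      (V := X) (W := Y)
      (by rw [hxx]; exact hX) (by rw [hxx]; exact hY) hsym
      (by rw [minSmoothness_of_isRCLikeNormedField])
    rw [← mlieBracketWithin_univ (I := 𝓘(ℝ, E)), mlieBracketWithin_eq_lieBracketWithin] at this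
    exact this.trans (congrFun (lieBracketWithin_univ (𝕜 := ℝ) (V := P X) (W := P Y)) (e x))
  have hd : DifferentiableAt ℝ (fderiv ℝ û) (e x) :=
    (hûd.fderiv_right (m := 1) (by norm_num)).differentiableAt one_ne_zero
  have hs : IsSymmSndFDerivAt ℝ û (e x) := hûd.isSymmSndFDerivAt (by simp)
  rw [hb, fderiv_clm_apply hd (hPd Y hY), fderiv_clm_apply hd (hPd X hX), lieBracket]
  -- Symmetry of the second derivative cancels all terms except the derivative of `û` along the
  -- bracket.
  have h1 := hs.eq (P X (e x)) (P Y (e x))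
  simp only [map_sub, add_apply, ContinuousLinearMap.comp_apply,
    ContinuousLinearMap.flip_apply, h1, ← hû]
  abel

/-! ### Smooth vector fields along a map. -/

variable (J) in
/-- The vector field `X` is smooth at `x`. -/
def SmoothFieldAt (X : Π x : N, TangentSpace J x) (x : N) : Prop :=
  ContMDiffAt J J.tangent ∞ (fun y => (⟨y, X y⟩ : TangentBundle J N)) x

variable (I J) in
/-- The vector field `Z` along the map `f` is smooth at `p`. -/
def SmoothAlongAt (f : M → N)
    (Z : Π p : M, TangentSpace J (f p)) (p : M) : Prop :=
  ContMDiffAt I J.tangent ∞ (fun q => (⟨f q, Z q⟩ : TangentBundle J N)) p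

theorem SmoothFieldAt.mdifferentiableAt {X : Π x : N, TangentSpace J x} {x : N}
    (h : SmoothFieldAt J X x) : MDiffAt (T% X) x :=
  ContMDiffAt.mdifferentiableAt h (by simp)

theorem smoothFieldAt_extend {x : N} (v : TangentSpace J x) :
    SmoothFieldAt J (FiberBundle.extend F v) x :=
  FiberBundle.contMDiffAt_extend J F v

theorem smoothAlongAt_iff {f : M → N} {Z : Π p : M, TangentSpace J (f p)} {p : M}
    (hf : ContMDiffAt I J ∞ f p) :
    SmoothAlongAt I J f Z p ↔ ContMDiffAt I 𝓘(ℝ, F) ∞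
      (fun q => (trivializationAt F (TangentSpace J : N → Type _) (f p) ⟨f q, Z q⟩).2) p := by
  rw [SmoothAlongAt, Bundle.contMDiffAt_totalSpace]
  exact and_iff_right hf

theorem SmoothAlongAt.add {f : M → N} {Z Z' : Π p : M, TangentSpace J (f p)} {p : M}
    (hf : ContMDiffAt I J ∞ f p) (h : SmoothAlongAt I J f Z p) (h' : SmoothAlongAt I J f Z' p) :
    SmoothAlongAt I J f (fun q => Z q + Z' q) p := by
  rw [smoothAlongAt_iff hf] at *
  refine (h.add h').congr_of_eventuallyEq ?_
  filter_upwards [hf.continuousAt.eventually ((trivializationAt F (TangentSpace J : N → Type _)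
    (f p)).open_baseSet.mem_nhds (FiberBundle.mem_baseSet_trivializationAt' (f p)))] with q hq
  exact ((trivializationAt F (TangentSpace J : N → Type _) (f p)).linear ℝ hq).map_add _ _

theorem SmoothAlongAt.smul {f : M → N} {Z : Π p : M, TangentSpace J (f p)} {h : M → ℝ} {p : M}
    (hf : ContMDiffAt I J ∞ f p) (hh : ContMDiffAt I 𝓘(ℝ, ℝ) ∞ h p)
    (hZ : SmoothAlongAt I J f Z p) :
    SmoothAlongAt I J f (fun q => h q • Z q) p := by
  rw [smoothAlongAt_iff hf] at *
  refine (ContMDiffAt.smul hh hZ).congr_of_eventuallyEq ?_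
  filter_upwards [hf.continuousAt.eventually ((trivializationAt F (TangentSpace J : N → Type _)
    (f p)).open_baseSet.mem_nhds (FiberBundle.mem_baseSet_trivializationAt' (f p)))] with q hq
  exact ((trivializationAt F (TangentSpace J : N → Type _) (f p)).linear ℝ hq).map_smul _ _

theorem SmoothFieldAt.comp {f : M → N} {W : Π x : N, TangentSpace J x} {p : M}
    (hf : ContMDiffAt I J ∞ f p) (hW : SmoothFieldAt J W (f p)) :
    SmoothAlongAt I J f (fun q => W (f q)) p :=
  ContMDiffAt.comp p hW hf

theorem SmoothFieldAt.map_mfderiv {f : M → N} {X : Π p : M, TangentSpace I p} {p : M}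
    (hf : ContMDiff I J ∞ f) (hX : SmoothFieldAt I X p) :
    SmoothAlongAt I J f (fun q => mfderiv I J f q (X q)) p :=
  ContMDiffAt.comp p (hf.contMDiff_tangentMap (m := ∞) (by simp)).contMDiffAt hX

theorem SmoothAlongAt.congr {f : M → N} {Z Z' : Π p : M, TangentSpace J (f p)} {p : M}
    (h : SmoothAlongAt I J f Z p) (hZ : ∀ᶠ q in 𝓝 p, Z' q = Z q) : SmoothAlongAt I J f Z' p := by
  refine ContMDiffAt.congr_of_eventuallyEq h ?_
  filter_upwards [hZ] with q hq
  rw [hq]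

/-- Along `f`, every smooth field is locally a combination of fields induced from the target. -/
theorem SmoothAlongAt.induction {f : M → N} {p : M} (hf : ContMDiffAt I J ∞ f p)
    {P : (Π p : M, TangentSpace J (f p)) → Prop}
    (comp : ∀ W : Π x : N, TangentSpace J x, SmoothFieldAt J W (f p) → P (fun q => W (f q)))
    (add : ∀ Z Z' : Π p : M, TangentSpace J (f p), SmoothAlongAt I J f Z p →
      SmoothAlongAt I J f Z' p → P Z → P Z' → P (fun q => Z q + Z' q))
    (smul : ∀ (h : M → ℝ) (Z : Π p : M, TangentSpace J (f p)), ContMDiffAt I 𝓘(ℝ, ℝ) ∞ h p →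
      SmoothAlongAt I J f Z p → P Z → P (fun q => h q • Z q))
    (congr : ∀ Z Z' : Π p : M, TangentSpace J (f p), (∀ᶠ q in 𝓝 p, Z' q = Z q) → P Z → P Z')
    {Z : Π p : M, TangentSpace J (f p)} (hZ : SmoothAlongAt I J f Z p) : P Z := by
  classical
  set t := trivializationAt F (TangentSpace J : N → Type _) (f p) with ht
  have hmem : f p ∈ t.baseSet := FiberBundle.mem_baseSet_trivializationAt' (f p)
  let b := Module.finBasis ℝ F
  -- A local frame of the target with constant components in the trivialization at `f p`; `Z` is
  -- expanded in it with smooth coefficients.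
  let W : Fin (Module.finrank ℝ F) → Π x : N, TangentSpace J x :=
    fun i => FiberBundle.extend F (t.symm (f p) (b i))
  have hW : ∀ i, SmoothFieldAt J (W i) (f p) := fun i => smoothFieldAt_extend _
  have hWt : ∀ i y, W i y = t.symm y (b i) := by
    intro i y
    change t.symm y (t ⟨f p, t.symm (f p) (b i)⟩).2 = _
    rw [t.apply_mk_symm hmem]
  rw [smoothAlongAt_iff hf] at hZ
  let c : Fin (Module.finrank ℝ F) → M → ℝ := fun i q => b.repr (t ⟨f q, Z q⟩).2 i
  have hc : ∀ i, ContMDiffAt I 𝓘(ℝ, ℝ) ∞ (c i) p := fun i =>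
    ((b.coord i).toContinuousLinearMap.contDiff.contMDiff.contMDiffAt).comp p hZ
  have hsum : ∀ s : Finset (Fin (Module.finrank ℝ F)),
      SmoothAlongAt I J f (fun q => ∑ i ∈ s, c i q • W i (f q)) p ∧
        P (fun q => ∑ i ∈ s, c i q • W i (f q)) := by
    intro s
    induction s using Finset.induction_on with
    | empty =>
      have h0 : SmoothFieldAt J (0 : Π x : N, TangentSpace J x) (f p) :=
        Bundle.contMDiff_zeroSection ℝ (TangentSpace J : N → Type _) (f p)
      simp only [Finset.sum_empty]
      exact ⟨h0.comp hf, comp 0 h0⟩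
    | insert i s hi ih =>
      have h1 := SmoothAlongAt.smul hf (hc i) ((hW i).comp hf)
      simp only [Finset.sum_insert hi]
      exact ⟨h1.add hf ih.1, add _ _ h1 ih.1
        (smul _ _ (hc i) ((hW i).comp hf) (comp _ (hW i))) ih.2⟩
  refine congr _ _ ?_ (hsum Finset.univ).2
  filter_upwards [hf.continuousAt.eventually (t.open_baseSet.mem_nhds hmem)] with q hq
  conv_lhs => rw [← t.symm_apply_apply_mk hq (Z q), ← b.sum_repr (t ⟨f q, Z q⟩).2]
  rw [← t.symmL_apply (R := ℝ) hq, map_sum]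
  simp only [map_smul]
  simp only [t.symmL_apply hq, hWt, c]

theorem trivializationAt_add {x y : N}
    (hy : y ∈ (trivializationAt F (TangentSpace J : N → Type _) x).baseSet)
    (v w : TangentSpace J y) :
    (trivializationAt F (TangentSpace J : N → Type _) x ⟨y, v + w⟩).2
      = (trivializationAt F (TangentSpace J : N → Type _) x ⟨y, v⟩).2
        + (trivializationAt F (TangentSpace J : N → Type _) x ⟨y, w⟩).2 :=
  ((trivializationAt F (TangentSpace J : N → Type _) x).linear ℝ hy).map_add _ _

theorem trivializationAt_smul {x y : N}
    (hy : y ∈ (trivializationAt F (TangentSpace J : N → Type _) x).baseSet)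
    (a : ℝ) (v : TangentSpace J y) :
    (trivializationAt F (TangentSpace J : N → Type _) x ⟨y, a • v⟩).2
      = a • (trivializationAt F (TangentSpace J : N → Type _) x ⟨y, v⟩).2 :=
  ((trivializationAt F (TangentSpace J : N → Type _) x).linear ℝ hy).map_smul _ _

theorem mvfderiv_congr {u u' : M → F} {p : M} (h : u =ᶠ[𝓝 p] u') :
    mvfderiv I u p = mvfderiv I u' p :=
  h.mfderiv_eq

theorem mvfderiv_comp_vec {F' : Type*} [NormedAddCommGroup F'] [NormedSpace ℝ F']
    {f : M → N} {u : N → F'} {p : M}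
    (hu : MDiffAt u (f p)) (hf : MDiffAt f p) (v : TangentSpace I p) :
    mvfderiv I (fun q => u (f q)) p v = mvfderiv J u (f p) (mfderiv I J f p v) :=
  mfderiv_comp_apply p hu hf v

/-! ### The pullback connection along a map. -/

variable (cov : CovariantDerivative J F (TangentSpace J : N → Type _))

theorem cov_congr {W W' : Π x : N, TangentSpace J x} {x : N} (hW : SmoothFieldAt J W x)
    (h : ∀ᶠ y in 𝓝 x, W' y = W y) : cov W' x = cov W x := by
  have hW' : SmoothFieldAt J W' x := by
    refine ContMDiffAt.congr_of_eventuallyEq hW ?_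
    filter_upwards [h] with q hq
    rw [hq]
  exact cov.isCovariantDerivativeOn.congr_of_eventuallyEq hW'.mdifferentiableAt
    hW.mdifferentiableAt Filter.univ_mem h

theorem SmoothFieldAt.add {W W' : Π x : N, TangentSpace J x} {x : N} (hW : SmoothFieldAt J W x)
    (hW' : SmoothFieldAt J W' x) : SmoothFieldAt J (W + W') x :=
  ContMDiffAt.add_section hW hW'

theorem SmoothFieldAt.smul {h : N → ℝ} {W : Π x : N, TangentSpace J x} {x : N}
    (hh : ContMDiffAt J 𝓘(ℝ, ℝ) ∞ h x) (hW : SmoothFieldAt J W x) :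
    SmoothFieldAt J (h • W) x :=
  ContMDiffAt.smul_section hh hW

/-- Near `x` the extension with constant components depends linearly on the vector. Hence the
Christoffel term of `covAlong` is linear in the value of the field. -/
theorem cov_extend_add {x : N} (v w : TangentSpace J x) :
    cov (FiberBundle.extend F (v + w)) x
      = cov (FiberBundle.extend F v) x + cov (FiberBundle.extend F w) x := by
  have hx := FiberBundle.mem_baseSet_trivializationAt' (F := F) (E := (TangentSpace J : N → Type _)) x
  rw [← cov.isCovariantDerivativeOn.add (smoothFieldAt_extend v).mdifferentiableAt
    (smoothFieldAt_extend w).mdifferentiableAt (Set.mem_univ x)]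
  refine cov_congr cov ((smoothFieldAt_extend v).add (smoothFieldAt_extend w)) ?_
  filter_upwards [(trivializationAt F (TangentSpace J : N → Type _) x).open_baseSet.mem_nhds hx]
    with y hy
  simp only [FiberBundle.extend, Pi.add_apply]
  rw [trivializationAt_add hx]
  rw [← Bundle.Trivialization.symmL_apply (R := ℝ) _ hy, map_add]
  simp only [Bundle.Trivialization.symmL_apply _ hy]

theorem cov_extend_smul {x : N} (a : ℝ) (v : TangentSpace J x) :
    cov (FiberBundle.extend F (a • v)) x = a • cov (FiberBundle.extend F v) x := by
  have hx := FiberBundle.mem_baseSet_trivializationAt' (F := F) (E := (TangentSpace J : N → Type _)) x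
  rw [← cov.isCovariantDerivativeOn.smul_const a (smoothFieldAt_extend v).mdifferentiableAt
    (Set.mem_univ x)]
  refine cov_congr cov (SmoothFieldAt.smul contMDiffAt_const (smoothFieldAt_extend v)) ?_
  filter_upwards [(trivializationAt F (TangentSpace J : N → Type _) x).open_baseSet.mem_nhds hx]
    with y hy
  simp only [FiberBundle.extend, Pi.smul_apply]
  rw [trivializationAt_smul hx]
  rw [← Bundle.Trivialization.symmL_apply (R := ℝ) _ hy, map_smul]
  simp only [Bundle.Trivialization.symmL_apply _ hy]

theorem covAlong_eq (f : M → N) (Z : Π p : M, TangentSpace J (f p)) (p : M)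
    (v : TangentSpace I p) :
    covAlong I cov f Z p v = (trivializationAt F (TangentSpace J : N → Type _) (f p)).symmL ℝ (f p)
      (mvfderiv I (fun q => (trivializationAt F (TangentSpace J : N → Type _) (f p)
        ⟨f q, Z q⟩).2) p v) + cov (FiberBundle.extend F (Z p)) (f p) (mfderiv I J f p v) := by
  rw [Bundle.Trivialization.symmL_apply _ (FiberBundle.mem_baseSet_trivializationAt' (f p))]
  rfl

theorem covAlong_congr {f : M → N} {Z Z' : Π p : M, TangentSpace J (f p)} {p : M}
    (h : ∀ᶠ q in 𝓝 p, Z' q = Z q) : covAlong I cov f Z' p = covAlong I cov f Z p := by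
  funext v
  rw [covAlong_eq, covAlong_eq, h.self_of_nhds, mvfderiv_congr]
  filter_upwards [h] with q hq
  rw [hq]

theorem covAlong_add {f : M → N} {Z Z' : Π p : M, TangentSpace J (f p)} {p : M}
    (hf : ContMDiffAt I J ∞ f p) (hZ : SmoothAlongAt I J f Z p) (hZ' : SmoothAlongAt I J f Z' p)
    (v : TangentSpace I p) :
    covAlong I cov f (fun q => Z q + Z' q) p v
      = covAlong I cov f Z p v + covAlong I cov f Z' p v := by
  rw [smoothAlongAt_iff hf] at hZ hZ'
  have hx := FiberBundle.mem_baseSet_trivializationAt' (F := F)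
    (E := (TangentSpace J : N → Type _)) (f p)
  simp only [covAlong_eq]
  rw [cov_extend_add, mvfderiv_congr (u' := fun q =>
      (trivializationAt F (TangentSpace J : N → Type _) (f p) ⟨f q, Z q⟩).2
      + (trivializationAt F (TangentSpace J : N → Type _) (f p) ⟨f q, Z' q⟩).2),
    mvfderiv_fun_add (hZ.mdifferentiableAt (by simp)) (hZ'.mdifferentiableAt (by simp))]
  · simp only [add_apply, map_add]
    abel
  · filter_upwards [hf.continuousAt.eventually ((trivializationAt F (TangentSpace J : N → Type _)
      (f p)).open_baseSet.mem_nhds hx)] with q hq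
    exact trivializationAt_add hq _ _

theorem covAlong_smul {f : M → N} {Z : Π p : M, TangentSpace J (f p)} {h : M → ℝ} {p : M}
    (hf : ContMDiffAt I J ∞ f p) (hh : ContMDiffAt I 𝓘(ℝ, ℝ) ∞ h p)
    (hZ : SmoothAlongAt I J f Z p) (v : TangentSpace I p) :
    covAlong I cov f (fun q => h q • Z q) p v
      = h p • covAlong I cov f Z p v + mvfderiv I h p v • Z p := by
  rw [smoothAlongAt_iff hf] at hZ
  have hx := FiberBundle.mem_baseSet_trivializationAt' (F := F)
    (E := (TangentSpace J : N → Type _)) (f p)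
  simp only [covAlong_eq]
  rw [cov_extend_smul, mvfderiv_congr (u' := fun q =>
      h q • (trivializationAt F (TangentSpace J : N → Type _) (f p) ⟨f q, Z q⟩).2),
    mvfderiv_fun_smul (hh.mdifferentiableAt (by simp)) (hZ.mdifferentiableAt (by simp))]
  · simp only [add_apply, map_add, smul_add, ContinuousLinearMap.smulRight_apply, map_smul,
      smul_apply]
    rw [Bundle.Trivialization.symmL_apply (R := ℝ) _ hx
      ((trivializationAt F (TangentSpace J : N → Type _) (f p) ⟨f p, Z p⟩).2),
      Bundle.Trivialization.symm_apply_apply_mk _ hx]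
    abel
  · filter_upwards [hf.continuousAt.eventually ((trivializationAt F (TangentSpace J : N → Type _)
      (f p)).open_baseSet.mem_nhds hx)] with q hq
    exact trivializationAt_smul hq _ _

/-- The expression of a covariant derivative in the trivialization at the base point. -/
theorem cov_eq_trivializationAt {W : Π x : N, TangentSpace J x} {x : N}
    (hW : SmoothFieldAt J W x) (u : TangentSpace J x) :
    cov W x u = (trivializationAt F (TangentSpace J : N → Type _) x).symmL ℝ x
      (mvfderiv J (fun y => (trivializationAt F (TangentSpace J : N → Type _) x
        ⟨y, W y⟩).2) x u) + cov (FiberBundle.extend F (W x)) x u := by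
  set t := trivializationAt F (TangentSpace J : N → Type _) x with ht
  have hx : x ∈ t.baseSet := FiberBundle.mem_baseSet_trivializationAt' x
  have hmd : ∀ W : Π x : N, TangentSpace J x, MDiffAt (T% W) x →
      MDiffAt (fun y => (t ⟨y, W y⟩).2) x := fun W hW => by
    rwa [mdifferentiableAt_section] at hW
  -- The difference between `cov` and the flat connection of the trivialization is tensorial, so `W`
  -- may be replaced by the extension of `W x`.
  have hten : TensorialAt J F (fun W : Π x : N, TangentSpace J x =>
      cov W x u - t.symmL ℝ x (mvfderiv J (fun y => (t ⟨y, W y⟩).2) x u)) x := by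
    constructor
    · intro h W hh hW
      rw [cov.isCovariantDerivativeOn.leibniz hW hh (Set.mem_univ x),
        mvfderiv_congr (u' := fun y => h y • (t ⟨y, W y⟩).2),
        mvfderiv_fun_smul hh (hmd W hW)]
      · simp only [add_apply, map_add, ContinuousLinearMap.smulRight_apply, map_smul, smul_apply]
        rw [Bundle.Trivialization.symmL_apply (R := ℝ) _ hx (t ⟨x, W x⟩).2,
          Bundle.Trivialization.symm_apply_apply_mk _ hx, smul_sub]
        abel
      · filter_upwards [t.open_baseSet.mem_nhds hx] with y hy
        exact trivializationAt_smul hy _ _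
    · intro W W' hW hW'
      rw [cov.isCovariantDerivativeOn.add hW hW' (Set.mem_univ x),
        mvfderiv_congr (u' := fun y => (t ⟨y, W y⟩).2 + (t ⟨y, W' y⟩).2),
        mvfderiv_fun_add (hmd W hW) (hmd W' hW')]
      · simp only [add_apply, map_add]
        abel
      · filter_upwards [t.open_baseSet.mem_nhds hx] with y hy
        exact trivializationAt_add hy _ _
  have h1 := hten.pointwise hW.mdifferentiableAt
    (smoothFieldAt_extend (W x)).mdifferentiableAt (FiberBundle.extend_apply_self F (W x)).symm
  -- The extension has constant components, so its flat derivative vanishes.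
  have h2 : mvfderiv J (fun y => (t ⟨y, FiberBundle.extend F (W x) y⟩).2) x = 0 := by
    rw [mvfderiv_congr (u' := fun _ => (t ⟨x, W x⟩).2), mvfderiv_const]
    filter_upwards [t.open_baseSet.mem_nhds hx] with y hy
    simp only [FiberBundle.extend, ← ht]
    rw [t.apply_mk_symm hy]
  simp only [h2, zero_apply, map_zero, sub_zero] at h1
  rw [← h1]
  abel

theorem covAlong_comp {f : M → N} {W : Π x : N, TangentSpace J x} {p : M}
    (hf : ContMDiffAt I J ∞ f p) (hW : SmoothFieldAt J W (f p)) (v : TangentSpace I p) :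
    covAlong I cov f (fun q => W (f q)) p v = cov W (f p) (mfderiv I J f p v) := by
  rw [covAlong_eq, cov_eq_trivializationAt cov hW]
  congr 2
  have h := hW.mdifferentiableAt
  rw [mdifferentiableAt_section] at h
  exact mvfderiv_comp_vec h (hf.mdifferentiableAt (by simp)) v

theorem SemiRiemannianMetric.contMDiffAt_inner (g : SemiRiemannianMetric J N) {f : M → N}
    {Z W : Π p : M, TangentSpace J (f p)} {p : M} (hf : ContMDiffAt I J ∞ f p)
    (hZ : SmoothAlongAt I J f Z p) (hW : SmoothAlongAt I J f W p) :
    ContMDiffAt I 𝓘(ℝ, ℝ) ∞ (fun q => g.inner (f q) (Z q) (W q)) p := by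
  have h : ContMDiffAt I (J.prod 𝓘(ℝ, ℝ)) ∞ (fun q => Bundle.TotalSpace.mk' ℝ
      (E := Bundle.Trivial N ℝ) (f q) (g.inner (f q) (Z q) (W q))) p := by
    apply ContMDiffAt.clm_bundle_apply₂ (F₁ := F) (F₂ := F)
      (E₁ := (TangentSpace J : N → Type _)) (E₂ := (TangentSpace J : N → Type _))
    · exact ContMDiffAt.comp p g.contMDiff.contMDiffAt hf
    · exact hZ
    · exact hW
  rw [Bundle.contMDiffAt_totalSpace] at h
  exact h.2

theorem SmoothAlongAt.clm_apply {φ : Π x : N, TangentSpace J x →L[ℝ] TangentSpace J x}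
    (hφ : ContMDiff J (J.prod 𝓘(ℝ, F →L[ℝ] F)) ∞
      (fun x => Bundle.TotalSpace.mk' (F →L[ℝ] F)
        (E := fun x : N => TangentSpace J x →L[ℝ] TangentSpace J x) x (φ x)))
    {f : M → N} {Z : Π p : M, TangentSpace J (f p)} {p : M} (hf : ContMDiffAt I J ∞ f p)
    (hZ : SmoothAlongAt I J f Z p) : SmoothAlongAt I J f (fun q => φ (f q) (Z q)) p := by
  refine ContMDiffAt.clm_bundle_apply (F₁ := F) (F₂ := F)
      (E₁ := (TangentSpace J : N → Type _)) (E₂ := (TangentSpace J : N → Type _))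
      (b := f) (ϕ := fun q => φ (f q)) ?_ hZ
  exact ContMDiffAt.comp p hφ.contMDiffAt hf

theorem SmoothFieldAt.clm_apply {φ : Π x : N, TangentSpace J x →L[ℝ] TangentSpace J x}
    (hφ : ContMDiff J (J.prod 𝓘(ℝ, F →L[ℝ] F)) ∞
      (fun x => Bundle.TotalSpace.mk' (F →L[ℝ] F)
        (E := fun x : N => TangentSpace J x →L[ℝ] TangentSpace J x) x (φ x)))
    {W : Π x : N, TangentSpace J x} {x : N} (hW : SmoothFieldAt J W x) :
    SmoothFieldAt J (fun y => φ y (W y)) x :=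
  SmoothAlongAt.clm_apply (f := id) (I := J) (M := N) hφ contMDiffAt_id hW

variable (cov : CovariantDerivative J F (TangentSpace J : N → Type _))

/-- Both sides obey the same sum and Leibniz rules in `Z` and in `W`. `SmoothAlongAt.induction`,
applied twice, reduces to fields pulled back from the target, where the chain rule and `∇g = 0`
apply. -/
theorem IsLeviCivita.mvfderiv_inner_along {g : SemiRiemannianMetric J N}
    {cov : CovariantDerivative J F (TangentSpace J : N → Type _)} (h : IsLeviCivita g cov)
    {f : M → N} {Z W : Π p : M, TangentSpace J (f p)} {p : M} (hf : ContMDiffAt I J ∞ f p)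
    (hZ : SmoothAlongAt I J f Z p) (hW : SmoothAlongAt I J f W p) (v : TangentSpace I p) :
    mvfderiv I (fun q => g.inner (f q) (Z q) (W q)) p v
      = g.inner (f p) (covAlong I cov f Z p v) (W p)
        + g.inner (f p) (Z p) (covAlong I cov f W p v) := by
  have hd : ∀ {Z W : Π p : M, TangentSpace J (f p)}, SmoothAlongAt I J f Z p →
      SmoothAlongAt I J f W p → MDiffAt (fun q => g.inner (f q) (Z q) (W q)) p :=
    fun hZ hW => (g.contMDiffAt_inner hf hZ hW).mdifferentiableAt (by simp)
  refine SmoothAlongAt.induction hf (P := fun Z => mvfderiv I (fun q => g.inner (f q) (Z q) (W q)) p v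
      = g.inner (f p) (covAlong I cov f Z p v) (W p)
        + g.inner (f p) (Z p) (covAlong I cov f W p v)) ?_ ?_ ?_ ?_ hZ
  · intro A hA
    refine SmoothAlongAt.induction hf (P := fun W =>
      mvfderiv I (fun q => g.inner (f q) (A (f q)) (W q)) p v
      = g.inner (f p) (covAlong I cov f (fun q => A (f q)) p v) (W p)
        + g.inner (f p) (A (f p)) (covAlong I cov f W p v)) ?_ ?_ ?_ ?_ hW
    · intro B hB
      rw [covAlong_comp cov hf hA, covAlong_comp cov hf hB,
        ← h.metric A B (f p) _ hA.mdifferentiableAt hB.mdifferentiableAt]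
      exact mvfderiv_comp_vec (u := fun y => g.inner y (A y) (B y))
        ((g.contMDiffAt_inner (f := id) contMDiffAt_id hA hB).mdifferentiableAt (by simp))
        (hf.mdifferentiableAt (by simp)) v
    · intro Z Z' hZ hZ' h1 h2
      simp only [map_add]
      rw [mvfderiv_fun_add (hd (hA.comp hf) hZ) (hd (hA.comp hf) hZ'), covAlong_add cov hf hZ hZ',
        add_apply, h1, h2, map_add]
      ring
    · intro c Z hc hZ h1
      simp only [map_smul]
      rw [mvfderiv_fun_smul (hc.mdifferentiableAt (by simp)) (hd (hA.comp hf) hZ),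
        covAlong_smul cov hf hc hZ]
      simp only [add_apply, smul_apply, h1, map_add, map_smul, smul_eq_mul,
        ContinuousLinearMap.smulRight_apply]
      ring
    · intro Z Z' hZZ h1
      rw [covAlong_congr cov hZZ, hZZ.self_of_nhds, ← h1, mvfderiv_congr]
      filter_upwards [hZZ] with q hq
      rw [hq]
  · intro Z Z' hZ hZ' h1 h2
    simp only [map_add, add_apply]
    rw [mvfderiv_fun_add (hd hZ hW) (hd hZ' hW), covAlong_add cov hf hZ hZ',
      add_apply, h1, h2, map_add, add_apply]
    ring
  · intro c Z hc hZ h1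
    simp only [map_smul, smul_apply]
    rw [mvfderiv_fun_smul (hc.mdifferentiableAt (by simp)) (hd hZ hW),
      covAlong_smul cov hf hc hZ]
    simp only [add_apply, smul_apply, h1, map_add, map_smul, smul_eq_mul,
      ContinuousLinearMap.smulRight_apply]
    ring
  · intro Z Z' hZZ h1
    rw [covAlong_congr cov hZZ, hZZ.self_of_nhds, ← h1, mvfderiv_congr]
    filter_upwards [hZZ] with q hq
    rw [hq]

/-! ### The covariant derivative of an endomorphism field. -/

/-- The covariant derivative `(∇_u φ) v` of a field of endomorphisms. -/
def covEnd (φ : Π x : N, TangentSpace J x →L[ℝ] TangentSpace J x) (x : N)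
    (u v : TangentSpace J x) : TangentSpace J x :=
  cov (fun y => φ y (FiberBundle.extend F v y)) x u - φ x (cov (FiberBundle.extend F v) x u)

/-- The derivative of a scalar factor contributes the same term twice, with opposite signs, because
`φ` is fibrewise linear. So the extension chosen in `covEnd` does not matter. -/
theorem tensorialAt_covEnd {φ : Π x : N, TangentSpace J x →L[ℝ] TangentSpace J x}
    (hφ : ContMDiff J (J.prod 𝓘(ℝ, F →L[ℝ] F)) ∞
      (fun x => Bundle.TotalSpace.mk' (F →L[ℝ] F)
        (E := fun x : N => TangentSpace J x →L[ℝ] TangentSpace J x) x (φ x)))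
    (x : N) (u : TangentSpace J x) :
    TensorialAt J F (fun W : Π x : N, TangentSpace J x =>
      cov (fun y => φ y (W y)) x u - φ x (cov W x u)) x := by
  have hd : ∀ W : Π x : N, TangentSpace J x, MDiffAt (T% W) x →
      MDiffAt (T% (fun y => φ y (W y))) x := by
    intro W hW
    refine MDifferentiableAt.clm_bundle_apply (F₁ := F) (F₂ := F)
      (E₁ := (TangentSpace J : N → Type _)) (E₂ := (TangentSpace J : N → Type _))
      (b := fun y => y) (ϕ := fun q => φ q) ?_ hW
    exact hφ.contMDiffAt.mdifferentiableAt (by simp)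
  constructor
  · intro h W hh hW
    have h1 : (fun y => φ y ((h • W) y)) = h • fun y => φ y (W y) := by
      funext y; simp
    rw [h1, cov.isCovariantDerivativeOn.leibniz (hd W hW) hh (Set.mem_univ x),
      cov.isCovariantDerivativeOn.leibniz hW hh (Set.mem_univ x)]
    simp [smul_sub]
  · intro W W' hW hW'
    have h1 : (fun y => φ y ((W + W') y)) = (fun y => φ y (W y)) + fun y => φ y (W' y) := by
      funext y; simp
    rw [h1, cov.isCovariantDerivativeOn.add (hd W hW) (hd W' hW') (Set.mem_univ x),
      cov.isCovariantDerivativeOn.add hW hW' (Set.mem_univ x)]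
    simp only [add_apply, map_add]
    abel

theorem covEnd_eq {φ : Π x : N, TangentSpace J x →L[ℝ] TangentSpace J x}
    (hφ : ContMDiff J (J.prod 𝓘(ℝ, F →L[ℝ] F)) ∞
      (fun x => Bundle.TotalSpace.mk' (F →L[ℝ] F)
        (E := fun x : N => TangentSpace J x →L[ℝ] TangentSpace J x) x (φ x)))
    {W : Π x : N, TangentSpace J x} {x : N} (hW : SmoothFieldAt J W x) (u : TangentSpace J x) :
    cov (fun y => φ y (W y)) x u - φ x (cov W x u) = covEnd cov φ x u (W x) :=
  (tensorialAt_covEnd cov hφ x u).pointwise hW.mdifferentiableAt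
    (smoothFieldAt_extend (W x)).mdifferentiableAt (FiberBundle.extend_apply_self F (W x)).symm

theorem covEnd_add {φ : Π x : N, TangentSpace J x →L[ℝ] TangentSpace J x}
    (hφ : ContMDiff J (J.prod 𝓘(ℝ, F →L[ℝ] F)) ∞
      (fun x => Bundle.TotalSpace.mk' (F →L[ℝ] F)
        (E := fun x : N => TangentSpace J x →L[ℝ] TangentSpace J x) x (φ x)))
    {x : N} (u v w : TangentSpace J x) :
    covEnd cov φ x u (v + w) = covEnd cov φ x u v + covEnd cov φ x u w := by
  have hv := smoothFieldAt_extend (J := J) v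
  have hw := smoothFieldAt_extend (J := J) w
  have h := (tensorialAt_covEnd cov hφ x u).add hv.mdifferentiableAt hw.mdifferentiableAt
  rw [covEnd_eq cov hφ (hv.add hw), covEnd_eq cov hφ hv, covEnd_eq cov hφ hw] at h
  simpa using h

theorem covEnd_smul {φ : Π x : N, TangentSpace J x →L[ℝ] TangentSpace J x}
    (hφ : ContMDiff J (J.prod 𝓘(ℝ, F →L[ℝ] F)) ∞
      (fun x => Bundle.TotalSpace.mk' (F →L[ℝ] F)
        (E := fun x : N => TangentSpace J x →L[ℝ] TangentSpace J x) x (φ x)))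
    {x : N} (a : ℝ) (u v : TangentSpace J x) :
    covEnd cov φ x u (a • v) = a • covEnd cov φ x u v := by
  have hv := smoothFieldAt_extend (J := J) v
  have hc : ContMDiffAt J 𝓘(ℝ, ℝ) ∞ (fun _ : N => a) x := contMDiffAt_const
  have h := (tensorialAt_covEnd cov hφ x u).smul (hc.mdifferentiableAt (by simp))
    hv.mdifferentiableAt
  rw [covEnd_eq cov hφ (hv.smul hc), covEnd_eq cov hφ hv] at h
  simpa using h

theorem covAlong_clm_apply {φ : Π x : N, TangentSpace J x →L[ℝ] TangentSpace J x}
    (hφ : ContMDiff J (J.prod 𝓘(ℝ, F →L[ℝ] F)) ∞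
      (fun x => Bundle.TotalSpace.mk' (F →L[ℝ] F)
        (E := fun x : N => TangentSpace J x →L[ℝ] TangentSpace J x) x (φ x)))
    {f : M → N} {Z : Π p : M, TangentSpace J (f p)} {p : M} (hf : ContMDiffAt I J ∞ f p)
    (hZ : SmoothAlongAt I J f Z p) (v : TangentSpace I p) :
    covAlong I cov f (fun q => φ (f q) (Z q)) p v
      = φ (f p) (covAlong I cov f Z p v) + covEnd cov φ (f p) (mfderiv I J f p v) (Z p) := by
  refine SmoothAlongAt.induction hf (P := fun Z => covAlong I cov f (fun q => φ (f q) (Z q)) p v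
      = φ (f p) (covAlong I cov f Z p v) + covEnd cov φ (f p) (mfderiv I J f p v) (Z p))
      ?_ ?_ ?_ ?_ hZ
  · intro W hW
    rw [covAlong_comp cov hf hW, covAlong_comp (W := fun y => φ y (W y)) cov hf (hW.clm_apply hφ),
      ← covEnd_eq cov hφ hW]
    abel
  · intro Z Z' hZ hZ' h1 h2
    simp only [map_add]
    rw [covAlong_add cov hf (hZ.clm_apply hφ hf) (hZ'.clm_apply hφ hf), h1, h2,
      covAlong_add cov hf hZ hZ', covEnd_add cov hφ, map_add]
    abel
  · intro c Z hc hZ h1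
    simp only [map_smul]
    rw [covAlong_smul cov hf hc (hZ.clm_apply hφ hf), h1, covAlong_smul cov hf hc hZ,
      covEnd_smul cov hφ, map_add, map_smul, map_smul, smul_add]
    abel
  · intro Z Z' hZZ h1
    rw [covAlong_congr cov hZZ, hZZ.self_of_nhds, ← h1, covAlong_congr]
    filter_upwards [hZZ] with q hq
    rw [hq]

/-! ### Coordinate fields and torsion-freeness along a map. -/

theorem trivializationAt_tangent {x y : N} (hy : y ∈ (chartAt G x).source) (v : TangentSpace J y) :
    (trivializationAt F (TangentSpace J : N → Type _) x ⟨y, v⟩).2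
      = mvfderiv J (extChartAt J x) y v := by
  have h := TangentBundle.continuousLinearMapAt_trivializationAt (I := J) hy
  have h2 := congrArg (fun A => A v) h
  rw [Bundle.Trivialization.continuousLinearMapAt_apply_of_mem] at h2
  · exact h2
  · exact hy

/-- Both extensions have constant components in the chart at `x`. The bracket therefore annihilates
the vector-valued chart map, whose differential at `x` is invertible. -/
theorem mlieBracket_extend {x : N} (v w : TangentSpace J x) :
    mlieBracket J (FiberBundle.extend F v) (FiberBundle.extend F w) x = 0 := by
  have hx : x ∈ (chartAt G x).source := mem_chart_source G x
  have hc := mvfderiv_mlieBracket (u := extChartAt J x) contMDiffAt_extChartAt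
    (smoothFieldAt_extend v).mdifferentiableAt (smoothFieldAt_extend w).mdifferentiableAt
  have hconst : ∀ v : TangentSpace J x,
      mvfderiv J (fun y => mvfderiv J (extChartAt J x) y (FiberBundle.extend F v y)) x = 0 := by
    intro v
    rw [mvfderiv_congr (u' := fun _ =>
      (trivializationAt F (TangentSpace J : N → Type _) x ⟨x, v⟩).2), mvfderiv_const]
    filter_upwards [(chartAt G x).open_source.mem_nhds hx] with y hy
    rw [← trivializationAt_tangent hy, FiberBundle.extend,
      Bundle.Trivialization.apply_mk_symm]
    exact hy
  rw [hconst, hconst] at hc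
  simp only [zero_apply, sub_zero] at hc
  obtain ⟨A, hA⟩ := isInvertible_mfderiv_extChartAt (I := J) (mem_extChartAt_source (I := J) x)
  have h0 : mfderiv J 𝓘(ℝ, F) (extChartAt J x) x
      (mlieBracket J (FiberBundle.extend F v) (FiberBundle.extend F w) x) = 0 := hc
  rw [← hA] at h0
  exact A.injective (h0.trans (map_zero A).symm)

/-- Let `u` be the chart at `f p` composed with `f`. The components of `df Y` are the derivative of
`u` along `Y`, so the antisymmetrized flat terms give the derivative of `u` along `[X, Y]`. The
Christoffel terms cancel because the torsion vanishes on commuting extensions. -/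
theorem IsLeviCivita.torsion_free_along {g : SemiRiemannianMetric J N}
    {cov : CovariantDerivative J F (TangentSpace J : N → Type _)} (h : IsLeviCivita g cov)
    {f : M → N} (hf : ContMDiff I J ∞ f) {X Y : Π p : M, TangentSpace I p} {p : M}
    (hX : SmoothFieldAt I X p) (hY : SmoothFieldAt I Y p) :
    covAlong I cov f (fun q => mfderiv I J f q (Y q)) p (X p)
      - covAlong I cov f (fun q => mfderiv I J f q (X q)) p (Y p)
      = mfderiv I J f p (mlieBracket I X Y p) := by
  have hfp : f p ∈ (chartAt G (f p)).source := mem_chart_source G (f p)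
  have hnear : ∀ᶠ q in 𝓝 p, f q ∈ (chartAt G (f p)).source :=
    hf.continuous.continuousAt.eventually ((chartAt G (f p)).open_source.mem_nhds hfp)
  have hloc : ∀ q, f q ∈ (chartAt G (f p)).source → ∀ X : Π p : M, TangentSpace I p,
      (trivializationAt F (TangentSpace J : N → Type _) (f p) ⟨f q, mfderiv I J f q (X q)⟩).2
        = mvfderiv I (fun q => extChartAt J (f p) (f q)) q (X q) := by
    intro q hq X
    rw [trivializationAt_tangent hq]
    exact (mvfderiv_comp_vec (u := extChartAt J (f p)) (mdifferentiableAt_extChartAt hq)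
      (hf.contMDiffAt.mdifferentiableAt (by simp)) (X q)).symm
  have hmv : ∀ X : Π p : M, TangentSpace I p, mvfderiv I (fun q =>
      (trivializationAt F (TangentSpace J : N → Type _) (f p) ⟨f q, mfderiv I J f q (X q)⟩).2) p
      = mvfderiv I (fun q => mvfderiv I (fun q => extChartAt J (f p) (f q)) q (X q)) p := by
    intro X
    refine mvfderiv_congr ?_
    filter_upwards [hnear] with q hq
    exact hloc q hq X
  have hu : ContMDiffAt I 𝓘(ℝ, F) 2 (fun q => extChartAt J (f p) (f q)) p :=
    ContMDiffAt.comp p contMDiffAt_extChartAt (hf.contMDiffAt.of_le ENat.LEInfty.out)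
  have hx := FiberBundle.mem_baseSet_trivializationAt' (F := F)
    (E := (TangentSpace J : N → Type _)) (f p)
  have htf := h.torsion_free _ _ (f p)
    (smoothFieldAt_extend (mfderiv I J f p (X p))).mdifferentiableAt
    (smoothFieldAt_extend (mfderiv I J f p (Y p))).mdifferentiableAt
  rw [mlieBracket_extend] at htf
  simp only [FiberBundle.extend_apply_self] at htf
  rw [covAlong_eq, covAlong_eq, hmv, hmv, add_sub_add_comm, htf, add_zero, ← map_sub,
    ← mvfderiv_mlieBracket hu hX.mdifferentiableAt hY.mdifferentiableAt,
    ← hloc p hfp (mlieBracket I X Y), Bundle.Trivialization.symmL_apply _ hx,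
    Bundle.Trivialization.symm_apply_apply_mk _ hx]

/-! ### Global extensions and smoothness of derived objects. -/

/-- The axioms of an `𝒮`-manifold speak of globally smooth fields, so local fields are multiplied by
a bump function supported in `W`. -/
theorem exists_smooth_cutoff [T2Space N] {W : Set N} (hW : IsOpen W) {x : N} (hx : x ∈ W)
    {X : Π x : N, TangentSpace J x} (hX : ∀ y ∈ W, SmoothFieldAt J X y) :
    ∃ ψ : N → ℝ, (∀ᶠ y in 𝓝 x, ψ y = 1) ∧ (∀ y, y ∉ W → ψ y = 0) ∧
      ∀ y, SmoothFieldAt J (ψ • X) y := by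
  obtain ⟨ψ, -, hψ⟩ := (SmoothBumpFunction.nhds_basis_tsupport (I := J) x).mem_iff.1
    (hW.mem_nhds hx)
  refine ⟨ψ, ψ.eventuallyEq_one, fun y hy => ?_, ?_⟩
  · exact image_eq_zero_of_notMem_tsupport fun h => hy (hψ h)
  · intro y
    refine ContMDiffOn.smul_section_of_tsupport (u := W) (n := ∞)
      (ψ.contMDiff.contMDiffOn) hW hψ ?_ y
    intro z hz
    exact ContMDiffAt.contMDiffWithinAt (hX z hz)

theorem exists_smoothField [T2Space N] {x : N} (v : TangentSpace J x) :
    ∃ X : Π x : N, TangentSpace J x, (∀ y, SmoothFieldAt J X y) ∧ X x = v := by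
  have h := FiberBundle.exists_contMDiffOn_extend (k := ∞) J F v
  obtain ⟨W, hW, hWs⟩ := h
  obtain ⟨W', hW', hW'o, hxW'⟩ := mem_nhds_iff.1 hW
  obtain ⟨ψ, h1, -, h2⟩ := exists_smooth_cutoff hW'o hxW' (X := FiberBundle.extend F v)
    (fun y hy => (hWs.mono hW').contMDiffAt (hW'o.mem_nhds hy))
  exact ⟨_, h2, by simp [h1.self_of_nhds]⟩

theorem contMDiffAt_mvfderiv_apply {u : N → ℝ} (hu : ContMDiff J 𝓘(ℝ, ℝ) ∞ u)
    {X : Π x : N, TangentSpace J x} {x : N} (hX : SmoothFieldAt J X x) :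
    ContMDiffAt J 𝓘(ℝ, ℝ) ∞ (fun y => mvfderiv J u y (X y)) x :=
  ContMDiffAt.comp x (contMDiff_snd_tangentBundle_modelSpace ℝ 𝓘(ℝ, ℝ)).contMDiffAt
    (hX.map_mfderiv (J := 𝓘(ℝ, ℝ)) hu)

theorem mvfderiv_finset_sum {ι : Type*} (A : Finset ι) {u : ι → N → ℝ} {x : N}
    (hu : ∀ i, ContMDiffAt J 𝓘(ℝ, ℝ) ∞ (u i) x) :
    mvfderiv J (fun y => ∑ i ∈ A, u i y) x = ∑ i ∈ A, mvfderiv J (u i) x := by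
  classical
  induction A using Finset.induction_on with
  | empty => simpa using mvfderiv_const (0 : ℝ)
  | insert i A hi ih =>
    simp only [Finset.sum_insert hi]
    rw [mvfderiv_fun_add ((hu i).mdifferentiableAt (by simp))
      ((ContMDiffAt.sum fun i _ => hu i).mdifferentiableAt (by simp)), ih]

theorem SmoothFieldAt.mlieBracket {X Y : Π x : N, TangentSpace J x} {x : N}
    (hX : SmoothFieldAt J X x) (hY : SmoothFieldAt J Y x) :
    SmoothFieldAt J (mlieBracket J X Y) x := by
  have : IsManifold J ((∞ : WithTop ℕ∞) + 1) N := by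
    change IsManifold J ∞ N
    infer_instance
  have : IsManifold J (minSmoothness ℝ 2) N := by
    rw [minSmoothness_of_isRCLikeNormedField]; infer_instance
  refine ContMDiffAt.mlieBracket_vectorField (m := ⊤) (n := ⊤) hX hY ?_
  rw [minSmoothness_of_isRCLikeNormedField]
  exact le_of_eq rfl

/-! ### Tensor identities on indefinite `𝒮`-manifolds. -/

namespace IndefiniteMetricGFF
variable {r : ℕ} (s : IndefiniteMetricGFF J N r)

theorem smoothFieldAt_ξ (α : Fin r) (x : N) : SmoothFieldAt J (s.ξ α) x :=
  (s.ξ_smooth α).contMDiffAt Filter.univ_mem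

theorem φ_ξ (x : N) (α : Fin r) : s.φ x (s.ξ α x) = 0 := by
  have h : s.ξ α x ∈ LinearMap.ker (s.φ x : TangentSpace J x →ₗ[ℝ] TangentSpace J x) := by
    rw [s.ker_φ]
    exact Submodule.subset_span ⟨α, rfl⟩
  exact h

/-- Applying `φ` to the formula for `φ²v` gives `φ³v = -φv`. Comparison with the formula for
`φ²(φv)` gives `∑ η^α(φv) ξ_α = 0`. -/
theorem η_φ (x : N) (α : Fin r) (v : TangentSpace J x) : s.η α x (s.φ x v) = 0 := by
  have h1 := s.φ_sq x (s.φ x v)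
  have h2 : s.φ x (s.φ x (s.φ x v)) = -s.φ x v := by
    rw [s.φ_sq x v, map_add, map_neg, map_sum]
    simp [s.φ_ξ]
  rw [h2] at h1
  have h3 := congrArg (s.η α x) (left_eq_add.1 h1)
  simpa [s.η_ξ] using h3

theorem inner_ξ (x : N) (α : Fin r) (v : TangentSpace J x) :
    s.metric.inner x v (s.ξ α x) = s.ε α * s.η α x v := by
  have h := s.compatible x v (s.ξ α x)
  simp only [s.φ_ξ, map_zero, s.η_ξ] at h
  simp at h
  linarith

theorem ε_mul_self (x : N) (α : Fin r) : s.ε α * s.ε α = 1 := by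
  rcases s.ε_eq x α with h | h <;> rw [h.2] <;> norm_num

theorem inner_φ_left (x : N) (v w : TangentSpace J x) :
    s.metric.inner x (s.φ x v) w = -s.metric.inner x v (s.φ x w) := by
  have h := s.compatible x v (s.φ x w)
  simp only [s.η_φ, mul_zero, Finset.sum_const_zero, sub_zero] at h
  rw [s.φ_sq, map_add, map_neg, map_sum] at h
  simp only [map_smul, s.inner_ξ, s.η_φ, smul_eq_mul, mul_zero, Finset.sum_const_zero] at h
  linarith

theorem η_eq (x : N) (α : Fin r) (v : TangentSpace J x) :
    s.η α x v = s.ε α * s.metric.inner x v (s.ξ α x) := by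
  rw [s.inner_ξ, ← mul_assoc, s.ε_mul_self x, one_mul]

variable (cov : CovariantDerivative J F (TangentSpace J : N → Type _))

/-- The trilinear form `g((∇_u φ) v, w)`. -/
def nablaPhi (x : N) (u v w : TangentSpace J x) : ℝ :=
  s.metric.inner x (covEnd cov s.φ x u v) w

/-- The bilinear form `g(∇_u ξ_α, v)`. -/
def nablaXi (α : Fin r) (x : N) (u v : TangentSpace J x) : ℝ :=
  s.metric.inner x (cov (s.ξ α) x u) v

variable {s cov}

theorem inner_cov_φ {Y : Π x : N, TangentSpace J x} {x : N} (hY : SmoothFieldAt J Y x)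
    (u w : TangentSpace J x) :
    s.metric.inner x (cov (fun y => s.φ y (Y y)) x u) w
      = s.nablaPhi cov x u (Y x) w + s.metric.inner x (s.φ x (cov Y x u)) w := by
  rw [nablaPhi, ← covEnd_eq cov s.φ_smooth hY, map_sub, sub_apply]
  ring

theorem metric_at (h : IsLeviCivita s.metric cov) {Y Z : Π x : N, TangentSpace J x} {x : N}
    (hY : SmoothFieldAt J Y x) (hZ : SmoothFieldAt J Z x) (v : TangentSpace J x) :
    mvfderiv J (fun y => s.metric.inner y (Y y) (Z y)) x v
        = s.metric.inner x (cov Y x v) (Z x) + s.metric.inner x (Y x) (cov Z x v) :=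
  h.metric Y Z x v hY.mdifferentiableAt hZ.mdifferentiableAt

theorem contMDiffAt_inner_field {Y Z : Π x : N, TangentSpace J x} {x : N}
    (hY : SmoothFieldAt J Y x) (hZ : SmoothFieldAt J Z x) :
    ContMDiffAt J 𝓘(ℝ, ℝ) ∞ (fun y => s.metric.inner y (Y y) (Z y)) x :=
  s.metric.contMDiffAt_inner (f := id) contMDiffAt_id hY hZ

/-- The skewness of `φ` is inherited by its covariant derivative. -/
theorem nablaPhi_skew (h : IsLeviCivita s.metric cov) (x : N) (u v w : TangentSpace J x) :
    s.nablaPhi cov x u v w = -s.nablaPhi cov x u w v := by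
  have hv := smoothFieldAt_extend (J := J) v
  have hw := smoothFieldAt_extend (J := J) w
  have h1 := metric_at h (hv.clm_apply s.φ_smooth) hw u
  have h2 := metric_at h hv (hw.clm_apply s.φ_smooth) u
  simp only [s.inner_φ_left] at h1
  rw [mvfderiv_fun_neg, neg_apply, h2] at h1
  have e1 := inner_cov_φ (s := s) (cov := cov) hv u w
  have e2 := inner_cov_φ (s := s) (cov := cov) hw u v
  simp only [FiberBundle.extend_apply_self] at h1 h2 e1 e2
  have e3 := s.inner_φ_left x (cov (FiberBundle.extend F v) x u) w
  have e4 := s.inner_φ_left x (cov (FiberBundle.extend F w) x u) v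
  have e5 := s.metric.symm x v (cov (fun y => s.φ y (FiberBundle.extend F w y)) x u)
  have e6 := s.metric.symm x (cov (FiberBundle.extend F w) x u) (s.φ x v)
  have e7 := s.inner_φ_left x v (cov (FiberBundle.extend F w) x u)
  have e8 := s.metric.symm x (s.φ x (cov (FiberBundle.extend F w) x u)) v
  linarith

/-- This is the covariant derivative of the compatibility between `φ` and `g`; the `nablaXi` terms
come from differentiating `η^α = ε_α g(·, ξ_α)`. -/
theorem nablaPhi_φ (h : IsLeviCivita s.metric cov) (x : N) (u v w : TangentSpace J x) :
    s.nablaPhi cov x u (s.φ x v) w = s.nablaPhi cov x u v (s.φ x w)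
      + ∑ α, (s.nablaXi cov α x u v * s.η α x w + s.η α x v * s.nablaXi cov α x u w) := by
  have hv := smoothFieldAt_extend (J := J) v
  have hw := smoothFieldAt_extend (J := J) w
  set Y := FiberBundle.extend F v with hYd
  set Z := FiberBundle.extend F w with hZd
  have hYx : Y x = v := FiberBundle.extend_apply_self F v
  have hZx : Z x = w := FiberBundle.extend_apply_self F w
  have h1 := metric_at h (hv.clm_apply s.φ_smooth) (hw.clm_apply s.φ_smooth) u
  -- The forms `η^α` are replaced by inner products with `ξ_α`, which `∇g = 0` can differentiate;
  -- `ε_α² = 1` keeps the sign.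
  have hfun : (fun y => s.metric.inner y (s.φ y (Y y)) (s.φ y (Z y))) = fun y =>
      s.metric.inner y (Y y) (Z y) - ∑ α, s.ε α *
        (s.metric.inner y (Y y) (s.ξ α y) * s.metric.inner y (Z y) (s.ξ α y)) := by
    funext y
    rw [s.compatible]
    congr 1
    refine Finset.sum_congr rfl fun α _ => ?_
    have := s.ε_mul_self y α
    rw [s.inner_ξ, s.inner_ξ]
    linear_combination (-(s.ε α * (s.η α y (Y y)) * (s.η α y (Z y)))) * this
  have hsm : ∀ α, ContMDiffAt J 𝓘(ℝ, ℝ) ∞ (fun y => s.ε α *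
        (s.metric.inner y (Y y) (s.ξ α y) * s.metric.inner y (Z y) (s.ξ α y))) x := fun α =>
    contMDiffAt_const.mul ((contMDiffAt_inner_field hv (s.smoothFieldAt_ξ α x)).mul
      (contMDiffAt_inner_field hw (s.smoothFieldAt_ξ α x)))
  have hterm : ∀ α, mvfderiv J (fun y => s.ε α *
        (s.metric.inner y (Y y) (s.ξ α y) * s.metric.inner y (Z y) (s.ξ α y))) x u
      = s.ε α * s.η α x (cov Y x u) * s.η α x w + s.ε α * s.η α x v * s.η α x (cov Z x u)
        + (s.nablaXi cov α x u v * s.η α x w + s.η α x v * s.nablaXi cov α x u w) := by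
    intro α
    have hξ := s.smoothFieldAt_ξ α x
    have hd : MDiffAt (fun y => s.metric.inner y (Y y) (s.ξ α y) *
        s.metric.inner y (Z y) (s.ξ α y)) x :=
      ((contMDiffAt_inner_field hv hξ).mul (contMDiffAt_inner_field hw hξ)).mdifferentiableAt
        (by simp)
    rw [mvfderiv_fun_mul mdifferentiableAt_const hd, mvfderiv_const, mvfderiv_fun_mul
      ((contMDiffAt_inner_field hv hξ).mdifferentiableAt (by simp))
      ((contMDiffAt_inner_field hw hξ).mdifferentiableAt (by simp))]
    simp only [add_apply, smul_apply, smul_zero, smul_eq_mul, add_zero]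
    rw [metric_at h hv hξ, metric_at h hw hξ, hYx, hZx]
    simp only [s.inner_ξ, nablaXi]
    have h1 := s.ε_mul_self x α
    have h2 := s.metric.symm x v (cov (s.ξ α) x u)
    have h3 := s.metric.symm x w (cov (s.ξ α) x u)
    rw [h2, h3]
    linear_combination (s.η α x (cov Y x u) * s.η α x w * s.ε α + s.η α x v * s.η α x (cov Z x u)
      * s.ε α + s.metric.inner x (cov (s.ξ α) x u) v * s.η α x w +
      s.metric.inner x (cov (s.ξ α) x u) w * s.η α x v) * h1
  rw [hfun, mvfderiv_fun_sub ((contMDiffAt_inner_field hv hw).mdifferentiableAt (by simp))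
    ((ContMDiffAt.sum fun α _ => hsm α).mdifferentiableAt (by simp)),
    mvfderiv_finset_sum _ hsm] at h1
  simp only [sub_apply, sum_apply, hterm, Finset.sum_add_distrib] at h1
  rw [metric_at h hv hw, hYx, hZx, inner_cov_φ hv, s.metric.symm x (s.φ x v), inner_cov_φ hw,
    s.compatible, s.compatible, hYx, hZx, nablaPhi_skew h x u w] at h1
  rw [Finset.sum_add_distrib]
  have e1 : ∑ α, s.ε α * s.η α x (cov Z x u) * s.η α x v
      = ∑ α, s.ε α * s.η α x v * s.η α x (cov Z x u) :=
    Finset.sum_congr rfl fun α _ => by ring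
  have e2 := s.metric.symm x v (cov Z x u)
  linarith

/-- Since `η^α` is metrically dual to `ε_α ξ_α` and the torsion vanishes, `2dη^α` is `ε_α` times the
antisymmetric part on the left; then `dη^α = Φ` is inserted. -/
theorem two_mul_inner_φ [T2Space N] (hs : s.IsSManifold) (h : IsLeviCivita s.metric cov) (x : N)
    (α : Fin r) (u v : TangentSpace J x) :
    s.nablaXi cov α x u v - s.nablaXi cov α x v u = 2 * s.ε α * s.metric.inner x u (s.φ x v) := by
  obtain ⟨X, hX, rfl⟩ := exists_smoothField u
  obtain ⟨Y, hY, rfl⟩ := exists_smoothField v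
  have hd := hs.dη_eq α X Y (fun y _ => (hX y).contMDiffWithinAt)
    (fun y _ => (hY y).contMDiffWithinAt) x
  have hξ := s.smoothFieldAt_ξ α x
  have hfun : ∀ X : Π x : N, TangentSpace J x, SmoothFieldAt J X x → ∀ u,
      mvfderiv J (fun y => s.η α y (X y)) x u = s.ε α * (s.metric.inner x (cov X x u) (s.ξ α x)
        + s.metric.inner x (X x) (cov (s.ξ α) x u)) := by
    intro X hX u
    simp only [s.η_eq]
    rw [mvfderiv_fun_mul mdifferentiableAt_const
      ((contMDiffAt_inner_field hX hξ).mdifferentiableAt (by simp)), mvfderiv_const]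
    simp only [smul_apply, smul_zero, smul_eq_mul, add_zero]
    rw [metric_at h hX hξ]
  have htf := h.torsion_free X Y x (hX x).mdifferentiableAt (hY x).mdifferentiableAt
  rw [extDeriv, hfun X (hX x), hfun Y (hY x), ← htf, s.η_eq, map_sub, sub_apply] at hd
  have h1 := s.ε_mul_self x α
  have h2 := s.metric.symm x (Y x) (cov (s.ξ α) x (X x))
  have h3 := s.metric.symm x (X x) (cov (s.ξ α) x (Y x))
  rw [h2, h3] at hd
  simp only [nablaXi]
  linear_combination (2 * s.ε α) * hd - (s.metric.inner x (cov (s.ξ α) x (X x)) (Y x)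
    - s.metric.inner x (cov (s.ξ α) x (Y x)) (X x)) * h1

/-- The fundamental form `Φ` of an `𝒮`-manifold is closed. -/
theorem nablaPhi_cyclic [T2Space N] (hr : 0 < r) (hs : s.IsSManifold)
    (h : IsLeviCivita s.metric cov) (x : N) (u v w : TangentSpace J x) :
    s.nablaPhi cov x u v w + s.nablaPhi cov x v w u + s.nablaPhi cov x w u v = 0 := by
  have := isManifold_minSmoothness_three J N
  obtain ⟨X, hX, rfl⟩ := exists_smoothField u
  obtain ⟨Y, hY, rfl⟩ := exists_smoothField v
  obtain ⟨Z, hZ, rfl⟩ := exists_smoothField w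
  -- Every `η^α` is a potential of `Φ`, so one index suffices.
  let α : Fin r := ⟨0, hr⟩
  let Fl : (Π x : N, TangentSpace J x) → N → ℝ := fun X y => s.η α y (X y)
  have hFl : ∀ X : Π x : N, TangentSpace J x, (∀ y, SmoothFieldAt J X y) →
      ContMDiff J 𝓘(ℝ, ℝ) ∞ (Fl X) := by
    intro X hX y
    simp only [Fl, s.η_eq]
    exact contMDiffAt_const.mul (contMDiffAt_inner_field (hX y) (s.smoothFieldAt_ξ α y))
  have hΦ : ∀ X Y : Π x : N, TangentSpace J x, (∀ y, SmoothFieldAt J X y) →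
      (∀ y, SmoothFieldAt J Y y) → ∀ y, 2 * s.metric.inner y (X y) (s.φ y (Y y))
        = mvfderiv J (Fl Y) y (X y) - mvfderiv J (Fl X) y (Y y)
          - Fl (mlieBracket J X Y) y := by
    intro X Y hX hY y
    have hd := hs.dη_eq α X Y (fun y _ => (hX y).contMDiffWithinAt)
      (fun y _ => (hY y).contMDiffWithinAt) y
    rw [extDeriv] at hd
    linarith
  have hbr : ∀ X Y : Π x : N, TangentSpace J x, (∀ y, SmoothFieldAt J X y) →
      (∀ y, SmoothFieldAt J Y y) → ∀ y, SmoothFieldAt J (mlieBracket J X Y) y :=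
    fun X Y hX hY y => (hX y).mlieBracket (hY y)
  -- `X (Φ(Y, Z)) - Φ([X, Y], Z)` in terms of `∇`
  have hA : ∀ X Y Z : Π x : N, TangentSpace J x, (∀ y, SmoothFieldAt J X y) →
      (∀ y, SmoothFieldAt J Y y) → (∀ y, SmoothFieldAt J Z y) →
      mvfderiv J (fun y => s.metric.inner y (Y y) (s.φ y (Z y))) x (X x)
        - s.metric.inner x (mlieBracket J X Y x) (s.φ x (Z x))
      = s.nablaPhi cov x (X x) (Z x) (Y x) + s.metric.inner x (s.φ x (cov Z x (X x))) (Y x)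
        - s.metric.inner x (s.φ x (cov X x (Y x))) (Z x) := by
    intro X Y Z hX hY hZ
    have htf := h.torsion_free X Y x (hX x).mdifferentiableAt (hY x).mdifferentiableAt
    rw [metric_at h (hY x) ((hZ x).clm_apply s.φ_smooth), ← htf, map_sub, sub_apply,
      s.metric.symm x (Y x), inner_cov_φ (hZ x), s.inner_φ_left x (cov X x (Y x))]
    ring
  -- the same quantity in terms of `η`
  have hB : ∀ X Y Z : Π x : N, TangentSpace J x, (∀ y, SmoothFieldAt J X y) →
      (∀ y, SmoothFieldAt J Y y) → (∀ y, SmoothFieldAt J Z y) →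
      2 * (mvfderiv J (fun y => s.metric.inner y (Y y) (s.φ y (Z y))) x (X x)
        - s.metric.inner x (mlieBracket J X Y x) (s.φ x (Z x)))
      = mvfderiv J (fun y => mvfderiv J (Fl Z) y (Y y)) x (X x)
        - mvfderiv J (fun y => mvfderiv J (Fl Y) y (Z y)) x (X x)
        - mvfderiv J (Fl (mlieBracket J Y Z)) x (X x)
        - (mvfderiv J (fun y => mvfderiv J (Fl Z) y (Y y)) x (X x)
          - mvfderiv J (fun y => mvfderiv J (Fl Z) y (X y)) x (Y x))
        + mvfderiv J (Fl (mlieBracket J X Y)) x (Z x)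
        + Fl (mlieBracket J (mlieBracket J X Y) Z) x := by
    intro X Y Z hX hY hZ
    have e1 := hΦ _ Z (hbr X Y hX hY) hZ x
    rw [mvfderiv_mlieBracket ((hFl Z hZ x).of_le ENat.LEInfty.out) (hX x).mdifferentiableAt
      (hY x).mdifferentiableAt] at e1
    have e2 : mvfderiv J (fun y => 2 * s.metric.inner y (Y y) (s.φ y (Z y))) x (X x)
        = 2 * mvfderiv J (fun y => s.metric.inner y (Y y) (s.φ y (Z y))) x (X x) := by
      rw [mvfderiv_fun_mul mdifferentiableAt_const ((contMDiffAt_inner_field (hY x)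
        ((hZ x).clm_apply s.φ_smooth)).mdifferentiableAt (by simp)), mvfderiv_const]
      simp
    have e3 : (fun y => 2 * s.metric.inner y (Y y) (s.φ y (Z y))) = fun y =>
        mvfderiv J (Fl Z) y (Y y) - mvfderiv J (Fl Y) y (Z y) - Fl (mlieBracket J Y Z) y :=
      funext (hΦ Y Z hY hZ)
    have s1 := (contMDiffAt_mvfderiv_apply (hFl Z hZ) (hY x)).mdifferentiableAt (by simp)
    have s2 := (contMDiffAt_mvfderiv_apply (hFl Y hY) (hZ x)).mdifferentiableAt (by simp)
    have s3 : MDiffAt (fun y => mvfderiv J (Fl Z) y (Y y) - mvfderiv J (Fl Y) y (Z y)) x :=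
      s1.sub s2
    rw [e3, mvfderiv_fun_sub s3
      ((hFl _ (hbr Y Z hY hZ) x).mdifferentiableAt (by simp)), mvfderiv_fun_sub s1 s2] at e2
    simp only [sub_apply] at e2
    linarith
  have hjac := leibniz_identity_mlieBracket_apply (I := J) (U := X) (V := Y) (W := Z) (x := x)
    (ContMDiffAt.of_le (hX x) (by rw [minSmoothness_of_isRCLikeNormedField]; exact ENat.LEInfty.out))
    (ContMDiffAt.of_le (hY x) (by rw [minSmoothness_of_isRCLikeNormedField]; exact ENat.LEInfty.out))
    (ContMDiffAt.of_le (hZ x) (by rw [minSmoothness_of_isRCLikeNormedField]; exact ENat.LEInfty.out))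
  have hneg : ∀ X : Π x : N, TangentSpace J x, Fl (-X) = -Fl X := by
    intro X; funext y; simp [Fl]
  have j1 : mlieBracket J (mlieBracket J X Y) Z x + mlieBracket J (mlieBracket J Y Z) X x
      + mlieBracket J (mlieBracket J Z X) Y x = 0 := by
    have e1 := mlieBracket_swap_apply (I := J) (V := X) (W := mlieBracket J Y Z) (x := x)
    have e2 := mlieBracket_swap_apply (I := J) (V := Y) (W := mlieBracket J X Z) (x := x)
    rw [mlieBracket_swap (V := X) (W := Z)] at e2
    rw [mlieBracket_swap (V := X) (W := Z), e1, e2] at hjac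
    have e : mlieBracket J (-mlieBracket J Z X) Y x = -mlieBracket J (mlieBracket J Z X) Y x := by
      have := mlieBracket_const_smul_left (I := J) (c := (-1 : ℝ)) (V := mlieBracket J Z X)
        (W := Y) ((hbr Z X hZ hX x).mdifferentiableAt)
      simpa using this
    rw [e, neg_neg] at hjac
    rw [add_right_comm, ← hjac, neg_add_cancel]
  have hcyc : Fl (mlieBracket J (mlieBracket J X Y) Z) x + Fl (mlieBracket J (mlieBracket J Y Z) X) x
      + Fl (mlieBracket J (mlieBracket J Z X) Y) x = 0 := by
    have := congrArg (s.η α x) j1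
    simpa [Fl] using this
  -- In the cyclic sum the connection terms of `hA` cancel in pairs, leaving `nablaPhi`. In that of
  -- `hB` the derivatives cancel in pairs and the iterated brackets vanish by Jacobi.
  have a1 := hA X Y Z hX hY hZ
  have a2 := hA Y Z X hY hZ hX
  have a3 := hA Z X Y hZ hX hY
  have b1 := hB X Y Z hX hY hZ
  have b2 := hB Y Z X hY hZ hX
  have b3 := hB Z X Y hZ hX hY
  have k1 := nablaPhi_skew h x (X x) (Z x) (Y x)
  have k2 := nablaPhi_skew h x (Y x) (X x) (Z x)
  have k3 := nablaPhi_skew h x (Z x) (Y x) (X x)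
  linarith

/-- Normality, paired with `w`, after brackets are written through `∇`. The `ξ_α` terms drop out
because `η^α(w) = 0` makes `w` orthogonal to `ξ_α`. -/
theorem nablaPhi_nijenhuis [T2Space N] (hs : s.IsSManifold)
    (h : IsLeviCivita s.metric cov) (x : N) (u v w : TangentSpace J x)
    (hw : ∀ α, s.η α x w = 0) :
    s.nablaPhi cov x (s.φ x u) v w - s.nablaPhi cov x (s.φ x v) u w
      + s.nablaPhi cov x u v (s.φ x w) - s.nablaPhi cov x v u (s.φ x w) = 0 := by
  obtain ⟨X, hX, rfl⟩ := exists_smoothField u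
  obtain ⟨Y, hY, rfl⟩ := exists_smoothField v
  have hn := hs.normal X Y (fun y _ => (hX y).contMDiffWithinAt)
    (fun y _ => (hY y).contMDiffWithinAt) x
  have hn2 := congrArg (fun a => s.metric.inner x a w) hn
  have hφX := (hX x).clm_apply s.φ_smooth
  have hφY := (hY x).clm_apply s.φ_smooth
  have hξw : ∀ α, s.metric.inner x (s.ξ α x) w = 0 := by
    intro α
    rw [s.metric.symm, s.inner_ξ, hw, mul_zero]
  rw [nijenhuis, ← h.torsion_free _ _ x hφX.mdifferentiableAt hφY.mdifferentiableAt,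
    ← h.torsion_free _ _ x hφX.mdifferentiableAt (hY x).mdifferentiableAt,
    ← h.torsion_free _ _ x (hX x).mdifferentiableAt hφY.mdifferentiableAt,
    ← h.torsion_free _ _ x (hX x).mdifferentiableAt (hY x).mdifferentiableAt] at hn2
  simp only [map_add, map_sub, add_apply, sub_apply, map_sum, sum_apply,
    map_smul, smul_apply, hξw, smul_zero, Finset.sum_const_zero, map_zero, zero_apply] at hn2
  simp only [s.inner_φ_left x _ w] at hn2
  rw [inner_cov_φ (hX x), inner_cov_φ (hY x), inner_cov_φ (hX x), inner_cov_φ (hY x)] at hn2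
  simp only [s.inner_φ_left x _ w] at hn2
  linarith

/-- On an `𝒮`-manifold, `(∇_e φ) v` is orthogonal to `w` if `e` is orthogonal to all `ξ_α` and to
`v` and `w`. -/
theorem nablaPhi_eq_zero [T2Space N] (hr : 0 < r) (hs : s.IsSManifold)
    (h : IsLeviCivita s.metric cov) (x : N) (e v w : TangentSpace J x)
    (he : ∀ α, s.η α x e = 0) (hv : s.metric.inner x e v = 0) (hw : s.metric.inner x e w = 0) :
    s.nablaPhi cov x e v w = 0 := by
  have hφφe : s.φ x (s.φ x e) = -e := by rw [s.φ_sq]; simp [he]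
  have hlin : ∀ a b c : TangentSpace J x, s.nablaPhi cov x a b (-c) = -s.nablaPhi cov x a b c :=
    fun a b c => by simp [nablaPhi]
  -- The vector `φe` lies in the kernel of every `η^α`, and `φ(φe) = -e` returns `e` to the last
  -- slot.
  have h1 := nablaPhi_nijenhuis hs h x v w (s.φ x e) (fun α => s.η_φ x α e)
  rw [hφφe, hlin, hlin] at h1
  have c1 := nablaPhi_cyclic hr hs h x e v w
  have k1 := nablaPhi_skew h x w e v
  have q1 := nablaPhi_φ h x (s.φ x v) w e
  have q2 := nablaPhi_φ h x (s.φ x w) v e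
  simp only [he, mul_zero, zero_add] at q1 q2
  have c2 := nablaPhi_cyclic hr hs h x e (s.φ x v) (s.φ x w)
  have k2 := nablaPhi_skew h x (s.φ x w) e (s.φ x v)
  have q3 := nablaPhi_φ h x e v (s.φ x w)
  simp only [s.η_φ, mul_zero, zero_add] at q3
  -- Differentiating `φξ_α = 0` gives `(∇_e φ)ξ_α = -φ(∇_e ξ_α)`.
  have hξ : ∀ α, s.nablaPhi cov x e v (s.ξ α x) = -s.nablaXi cov α x e (s.φ x v) := by
    intro α
    rw [nablaPhi_skew h]
    have := inner_cov_φ (cov := cov) (s := s) (s.smoothFieldAt_ξ α x) e v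
    simp only [s.φ_ξ] at this
    have h0 : cov (fun y : N => (0 : TangentSpace J y)) = 0 := cov.zero
    rw [h0, s.inner_φ_left] at this
    simp only [Pi.zero_apply, zero_apply, map_zero] at this
    rw [nablaXi]
    linarith
  have q4 : s.nablaPhi cov x e v (s.φ x (s.φ x w)) = -s.nablaPhi cov x e v w
      - ∑ α, s.η α x w * s.nablaXi cov α x e (s.φ x v) := by
    rw [s.φ_sq, nablaPhi, map_add, map_neg, map_sum]
    simp only [map_smul, smul_eq_mul]
    have : ∀ α, s.metric.inner x (covEnd cov s.φ x e v) (s.ξ α x)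
      = -s.nablaXi cov α x e (s.φ x v) := hξ
    simp only [this, mul_neg, Finset.sum_neg_distrib]
    rw [nablaPhi]
    ring
  -- The antisymmetric part of `∇ξ_α` on `(e, φv)` is `2ε_α g(e, φ²v) = -2ε_α g(e, v)`. The
  -- orthogonality of `e` to `v` and `w` enters only here.
  have hsymm : ∀ v, s.metric.inner x e v = 0 → ∀ α,
      s.nablaXi cov α x e (s.φ x v) = s.nablaXi cov α x (s.φ x v) e := by
    intro v hv α
    have := two_mul_inner_φ hs h x α e (s.φ x v)
    rw [s.φ_sq, map_add, map_neg, map_sum, hv] at this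
    simp only [map_smul, s.inner_ξ, he, mul_zero, smul_zero, Finset.sum_const_zero, neg_zero,
      add_zero] at this
    linarith
  simp only [hsymm v hv] at q4
  simp only [hsymm w hw] at q3
  -- Closedness turns `h1` into `T(e, v, w) - T(e, φv, φw)` plus `∇ξ` terms, and `q3`, `q4` give
  -- `T(e, φv, φw) = -T(e, v, w)` plus `∇ξ` terms. All these corrections cancel by `hsymm`, leaving
  -- `2T(e, v, w) = 0`.
  linarith

end IndefiniteMetricGFF

/-! ### Linear algebra of a lightlike hyperplane. -/

section Algebra

variable {g : SemiRiemannianMetric J N} {f : M → N} {p : M} {e : TangentSpace I p}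

theorem inner_mfderiv_radical (he : e ∈ radical I g f p) (x : TangentSpace I p) :
    g.inner (f p) (mfderiv I J f p x) (mfderiv I J f p e) = 0 := by
  rw [g.symm]
  exact he x

/-- The tangent space lies in the orthogonal complement of `e`, and both have codimension one. -/
theorem mem_tangentImage_iff (hf : IsLightlikeHypersurface I g f) (he : e ∈ radical I g f p)
    (he0 : e ≠ 0) (w : TangentSpace J (f p)) :
    w ∈ tangentImage I J f p ↔ g.inner (f p) w (mfderiv I J f p e) = 0 := by
  have : FiniteDimensional ℝ (TangentSpace J (f p)) := inferInstanceAs (FiniteDimensional ℝ F)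
  set l : TangentSpace J (f p) →ₗ[ℝ] ℝ := (g.inner (f p) (mfderiv I J f p e)).toLinearMap with hl
  have hT : tangentImage I J f p = LinearMap.ker l := by
    apply Submodule.eq_of_le_of_finrank_eq
    · rintro _ ⟨w, rfl⟩
      exact he w
    · have h1 := LinearMap.finrank_range_add_finrank_ker l
      have h2 : l ≠ 0 := fun h => he0 (hf.injective_mfderiv p (by
        rw [map_zero]
        exact g.nondegenerate _ _ fun w => LinearMap.congr_fun h w))
      have h3 : Module.finrank ℝ (LinearMap.range l) = 1 := by
        rw [LinearMap.range_eq_top.2 (LinearMap.surjective h2)]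
        simp
      have h4 : Module.finrank ℝ (tangentImage I J f p) = Module.finrank ℝ E :=
        LinearMap.finrank_range_of_inj (hf.injective_mfderiv p)
      have h5 : Module.finrank ℝ (TangentSpace J (f p)) = Module.finrank ℝ F := rfl
      have := hf.codim_one
      omega
  rw [hT, LinearMap.mem_ker, g.symm]
  rfl

theorem exists_eq_smul_of_orthogonal (hf : IsLightlikeHypersurface I g f)
    (he : e ∈ radical I g f p) (he0 : e ≠ 0) {u : TangentSpace J (f p)}
    (hu : ∀ w, g.inner (f p) u (mfderiv I J f p w) = 0) : ∃ c : ℝ, u = c • mfderiv I J f p e := by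
  set e' := mfderiv I J f p e with he'
  have hex : ∃ w, g.inner (f p) e' w ≠ 0 := by
    by_contra! h
    exact he0 (hf.injective_mfderiv p (by rw [map_zero]; exact g.nondegenerate _ _ h))
  obtain ⟨w₀, hw₀⟩ := hex
  refine ⟨g.inner (f p) u w₀ / g.inner (f p) e' w₀, sub_eq_zero.1 (g.nondegenerate _ _ ?_)⟩
  intro w
  -- Any `w` becomes tangent after subtracting the multiple of `w₀` that carries its pairing with
  -- `e'`.
  have hw : w - (g.inner (f p) e' w / g.inner (f p) e' w₀) • w₀ ∈ tangentImage I J f p := by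
    rw [mem_tangentImage_iff hf he he0, g.symm, map_sub, map_smul, smul_eq_mul,
      div_mul_cancel₀ _ hw₀, sub_self]
  obtain ⟨y, hy⟩ := hw
  have h1 := hu y
  rw [show mfderiv I J f p y = _ from hy, map_sub, map_smul, smul_eq_mul] at h1
  rw [map_sub, map_smul, sub_apply, smul_apply, smul_eq_mul]
  field_simp at h1 ⊢
  linarith

theorem exists_eq_smul_of_mem_radical (hf : IsLightlikeHypersurface I g f)
    (he : e ∈ radical I g f p) (he0 : e ≠ 0) {x : TangentSpace I p} (hx : x ∈ radical I g f p) :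
    ∃ c : ℝ, x = c • e := by
  obtain ⟨c, hc⟩ := exists_eq_smul_of_orthogonal hf he he0 (u := mfderiv I J f p x) hx
  exact ⟨c, hf.injective_mfderiv p (by rw [hc, map_smul])⟩

theorem mfderiv_pull {w : TangentSpace J (f p)} (hw : w ∈ tangentImage I J f p) :
    mfderiv I J f p (pull I f p w) = w :=
  Function.invFun_eq hw

variable {S : Π p : M, Submodule ℝ (TangentSpace I p)}

theorem exists_eq_smul_add_screen (hf : IsLightlikeHypersurface I g f) (hS : IsScreen I g f S)
    (he : e ∈ radical I g f p) (he0 : e ≠ 0) (x : TangentSpace I p) :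
    ∃ c : ℝ, ∃ y ∈ S p, x = c • e + y := by
  have hw : x ∈ radical I g f p ⊔ S p := by
    rw [(hS.isCompl p).sup_eq_top]; trivial
  obtain ⟨z, hz, y, hy, rfl⟩ := Submodule.mem_sup.1 hw
  obtain ⟨c, rfl⟩ := exists_eq_smul_of_mem_radical hf he he0 hz
  exact ⟨c, y, hy, rfl⟩

/-- The discarded tangent part is orthogonal to the radical. Hence `B(X, Y) = g(∇_X Y, E)`,
independently of the screen. -/
theorem inner_ltrComponent (hf : IsLightlikeHypersurface I g f) (hS : IsScreen I g f S)
    (he : e ∈ radical I g f p) (w : TangentSpace J (f p)) :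
    g.inner (f p) (ltrComponent I g f S p w) (mfderiv I J f p e)
      = g.inner (f p) w (mfderiv I J f p e) := by
  have h := isCompl_ltr_tangentImage I hf hS p
  rw [ltrComponent, dif_pos h]
  have hsum := Submodule.projection_add_projection_eq_self h w
  obtain ⟨y, hy⟩ : Submodule.projection _ _ h.symm w ∈ tangentImage I J f p :=
    Submodule.projection_apply_mem h.symm w
  conv_rhs => rw [← hsum]
  rw [map_add, add_apply, ← hy]
  have := inner_mfderiv_radical he y
  erw [this, add_zero]

/-- A lightlike transversal vector which is not tangent. -/
theorem exists_ltr_generator (hf : IsLightlikeHypersurface I g f) (hS : IsScreen I g f S)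
    (he : e ∈ radical I g f p) (he0 : e ≠ 0) : ∃ n ∈ ltr I g f S p,
      g.inner (f p) n (mfderiv I J f p e) ≠ 0 ∧
      ∀ w ∈ S p, g.inner (f p) n (mfderiv I J f p w) = 0 := by
  by_contra! hcon
  have hbot : ltr I g f S p = ⊥ := by
    refine Submodule.span_eq_bot.2 ?_
    rintro n ⟨⟨e', he', hn⟩, hnn, hnS⟩
    exfalso
    obtain ⟨c, rfl⟩ := exists_eq_smul_of_mem_radical hf he he0 he'
    obtain ⟨w, hw, hw0⟩ := hcon n (Submodule.subset_span ⟨⟨_, he', hn⟩, hnn, hnS⟩) (fun h => by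
      rw [map_smul, map_smul, h, smul_zero] at hn
      exact zero_ne_one hn)
    exact hw0 (hnS w hw)
  have h := (isCompl_ltr_tangentImage I hf hS p).sup_eq_top
  rw [hbot, bot_sup_eq] at h
  apply he0
  apply hf.injective_mfderiv p
  rw [map_zero]
  refine g.nondegenerate _ _ fun w => ?_
  rw [g.symm, ← mem_tangentImage_iff hf he he0, h]
  trivial

end Algebra

/-! ### Pointwise structure of `D₀` and `D`. -/

section Characteristic

variable {r : ℕ} {s : IndefiniteMetricGFF J N r} {f : M → N}
  {S : Π p : M, Submodule ℝ (TangentSpace I p)} {p : M} {e : TangentSpace I p}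

namespace IsCharacteristic

theorem η_radical (hchar : IsCharacteristic I s f S) (he : e ∈ radical I s.metric f p)
    (α : Fin r) : s.η α (f p) (mfderiv I J f p e) = 0 := by
  obtain ⟨y, hy⟩ := hchar.ξ_tangent p α
  rw [s.η_eq, ← hy]
  erw [he y, mul_zero]

theorem φ_φ_radical (hchar : IsCharacteristic I s f S) (he : e ∈ radical I s.metric f p) :
    s.φ (f p) (s.φ (f p) (mfderiv I J f p e)) = -mfderiv I J f p e := by
  rw [s.φ_sq]
  simp [hchar.η_radical he]

theorem inner_φ_self (x : N) (v : TangentSpace J x) : s.metric.inner x v (s.φ x v) = 0 := by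
  have h1 := s.inner_φ_left x v v
  rw [s.metric.symm] at h1
  linarith

theorem inner_φ_φ_radical (hchar : IsCharacteristic I s f S) (he : e ∈ radical I s.metric f p) :
    s.metric.inner (f p) (s.φ (f p) (mfderiv I J f p e)) (s.φ (f p) (mfderiv I J f p e)) = 0 := by
  rw [s.inner_φ_left, hchar.φ_φ_radical he, map_neg, neg_neg]
  exact he e

theorem exists_screen_eq_φ_radical (hchar : IsCharacteristic I s f S)
    (he : e ∈ radical I s.metric f p) :
    ∃ v ∈ S p, mfderiv I J f p v = s.φ (f p) (mfderiv I J f p e) :=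
  hchar.phi_radical_le p ⟨_, ⟨e, he, rfl⟩, rfl⟩

variable (hf : IsLightlikeHypersurface I s.metric f) (hS : IsScreen I s.metric f S)
  (hchar : IsCharacteristic I s f S) (he : e ∈ radical I s.metric f p) (he0 : e ≠ 0)
include hf hS hchar he he0

theorem φ_mem_tangentImage_iff (x : TangentSpace J (f p)) :
    s.φ (f p) x ∈ tangentImage I J f p
      ↔ s.metric.inner (f p) x (s.φ (f p) (mfderiv I J f p e)) = 0 := by
  rw [mem_tangentImage_iff hf he he0, s.inner_φ_left, neg_eq_zero]

/-- By skewness of `φ`, orthogonality of `v` to `φ(Rad)` makes `φv` tangent, and orthogonality to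
`φ(ltr)` removes the radical component of `φv`. So `D₀` consists of the `v` in the screen with `φv`
in the screen. -/
theorem mem_distD₀_iff (v : TangentSpace I p) : v ∈ distD₀ I s f S p ↔
    v ∈ S p ∧ ∃ u ∈ S p, mfderiv I J f p u = s.φ (f p) (mfderiv I J f p v) := by
  constructor
  · rintro ⟨hvS, hv⟩
    refine ⟨hvS, ?_⟩
    have hT := (φ_mem_tangentImage_iff hf hS hchar he he0 _).2
      (hv _ (Submodule.mem_sup_left ⟨_, ⟨e, he, rfl⟩, rfl⟩))
    obtain ⟨u, hu⟩ := hT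
    obtain ⟨c, y, hy, rfl⟩ := exists_eq_smul_add_screen hf hS he he0 u
    obtain ⟨n, hn, hne, hnS⟩ := exists_ltr_generator hf hS he he0
    have h1 := hv _ (Submodule.mem_sup_right ⟨n, hn, rfl⟩)
    change s.metric.inner (f p) _ (s.φ (f p) n) = 0 at h1
    have h2 := s.inner_φ_left (f p) (mfderiv I J f p v) n
    change mfderiv I J f p (c • e + y) = _ at hu
    rw [h1, neg_zero, s.metric.symm, ← hu, map_add, map_smul, map_add, map_smul, hnS y hy, add_zero,
      smul_eq_mul] at h2
    have hc := (mul_eq_zero.1 h2).resolve_right hne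
    rw [hc, zero_smul, zero_add] at hu
    exact ⟨y, hy, hu⟩
  · rintro ⟨hvS, u, huS, hu⟩
    refine ⟨hvS, fun z hz => ?_⟩
    obtain ⟨_, ⟨_, ⟨e', he', rfl⟩, rfl⟩, _, ⟨n, hn, rfl⟩, rfl⟩ := Submodule.mem_sup.1 hz
    have h1 : s.metric.inner (f p) (mfderiv I J f p v) (s.φ (f p) (mfderiv I J f p e')) = 0 := by
      have := s.inner_φ_left (f p) (mfderiv I J f p v) (mfderiv I J f p e')
      rw [← hu, inner_mfderiv_radical he'] at this
      linarith
    have h2 : s.metric.inner (f p) (mfderiv I J f p v) (s.φ (f p) n) = 0 := by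
      have h3 : s.metric.inner (f p) n (mfderiv I J f p u) = 0 := by
        clear hz
        induction hn using Submodule.span_induction with
        | mem x hx => exact hx.2.2 u huS
        | zero => simp
        | add x y _ _ hx hy => simp [hx, hy]
        | smul c x _ hx => simp [hx]
      have := s.inner_φ_left (f p) (mfderiv I J f p v) n
      rw [← hu, s.metric.symm, h3] at this
      linarith
    change s.metric.inner (f p) (mfderiv I J f p v)
      (s.φ (f p) (mfderiv I J f p e') + s.φ (f p) n) = 0
    rw [map_add, h1, h2, add_zero]

/-- Invariance of `D₀` under `φ`: the vector `φ²v = -v + ∑ η^α(v) ξ_α` stays in the screen, which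
contains `ker φ`. -/
theorem exists_φ_distD₀ {v : TangentSpace I p} (hv : v ∈ distD₀ I s f S p) :
    ∃ u ∈ distD₀ I s f S p, mfderiv I J f p u = s.φ (f p) (mfderiv I J f p v) := by
  obtain ⟨hvS, u, huS, hu⟩ := (mem_distD₀_iff hf hS hchar he he0 v).1 hv
  refine ⟨u, (mem_distD₀_iff hf hS hchar he he0 u).2 ⟨huS, ?_⟩, hu⟩
  have hker : ∑ α, s.η α (f p) (mfderiv I J f p v) • s.ξ α (f p) ∈ push I f p (S p) := by
    refine Submodule.sum_mem _ fun α _ => Submodule.smul_mem _ _ (hchar.ker_le p ?_)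
    exact s.φ_ξ (f p) α
  obtain ⟨y, hy, hy'⟩ := hker
  refine ⟨-v + y, add_mem (neg_mem hvS) hy, ?_⟩
  rw [hu, s.φ_sq, ← hy', map_add, map_neg]
  rfl

variable {v₀ : TangentSpace I p} (hv₀S : v₀ ∈ S p)
  (hv₀ : mfderiv I J f p v₀ = -s.φ (f p) (mfderiv I J f p e))
include hv₀S hv₀

theorem exists_decomposition {x : TangentSpace I p}
    (hx : s.metric.inner (f p) (mfderiv I J f p x) (s.φ (f p) (mfderiv I J f p e)) = 0) :
    ∃ x₀ ∈ distD₀ I s f S p, ∃ a c : ℝ, x = x₀ + a • v₀ + c • e := by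
  obtain ⟨c, y, hy, rfl⟩ := exists_eq_smul_add_screen hf hS he he0 x
  have hy1 : s.metric.inner (f p) (mfderiv I J f p y) (s.φ (f p) (mfderiv I J f p e)) = 0 := by
    rw [map_add, map_smul, map_add, map_smul, add_apply, smul_apply, inner_φ_self, smul_zero,
      zero_add] at hx
    exact hx
  obtain ⟨u, hu⟩ := (φ_mem_tangentImage_iff hf hS hchar he he0 _).2 hy1
  obtain ⟨a, y', hy', rfl⟩ := exists_eq_smul_add_screen hf hS he he0 u
  -- Here `a` is the radical coefficient of `φy`. Since `φv₀ = e`, subtracting `a • v₀` from `y`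
  -- leaves the image `y'`, which is in the screen.
  refine ⟨y - a • v₀, (mem_distD₀_iff hf hS hchar he he0 _).2
    ⟨sub_mem hy (Submodule.smul_mem _ _ hv₀S), y', hy', ?_⟩, a, c, by abel⟩
  change mfderiv I J f p (a • e + y') = _ at hu
  rw [map_sub, map_smul, hv₀, map_sub, map_smul, map_neg, hchar.φ_φ_radical he, neg_neg, ← hu,
    map_add, map_smul]
  abel

/-- All three summands are orthogonal to `φe`: `D₀` by definition, `φe` because it is null, and `e`
by skewness of `φ`. The converse is `exists_decomposition`. -/
theorem mem_distD_iff (x : TangentSpace I p) : x ∈ distD I s f S p ↔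
    s.metric.inner (f p) (mfderiv I J f p x) (s.φ (f p) (mfderiv I J f p e)) = 0 := by
  constructor
  · intro hx
    obtain ⟨w, hw, z, hz, rfl⟩ := Submodule.mem_sup.1 hx
    obtain ⟨x₁, hx₁, y, hy, rfl⟩ := Submodule.mem_sup.1 hw
    have h1 := hx₁.2 _ (Submodule.mem_sup_left ⟨_, ⟨e, he, rfl⟩, rfl⟩)
    obtain ⟨_, ⟨y', hy', rfl⟩, hyy⟩ := hy
    obtain ⟨a, rfl⟩ := exists_eq_smul_of_mem_radical hf he he0 hy'
    obtain ⟨c, rfl⟩ := exists_eq_smul_of_mem_radical hf he he0 hz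
    have h2 : mfderiv I J f p y = a • s.φ (f p) (mfderiv I J f p e) := by
      rw [← map_smul, ← map_smul]
      exact hyy.symm
    change s.metric.inner (f p) (mfderiv I J f p x₁) (s.φ (f p) (mfderiv I J f p e)) = 0 at h1
    simp only [map_add, map_smul, h2, add_apply, smul_apply, h1, hchar.inner_φ_φ_radical he,
      inner_φ_self, smul_zero, add_zero]
  · intro hx
    obtain ⟨x₀, hx₀, a, c, rfl⟩ := exists_decomposition hf hS hchar he he0 hv₀S hv₀ hx
    refine add_mem (Submodule.mem_sup_left (add_mem (Submodule.mem_sup_left hx₀)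
      (Submodule.mem_sup_right ?_))) (Submodule.mem_sup_right (Submodule.smul_mem _ _ he))
    refine Submodule.smul_mem _ _ ⟨_, ⟨-e, neg_mem he, rfl⟩, ?_⟩
    change s.φ (f p) (mfderiv I J f p (-e)) = mfderiv I J f p v₀
    rw [hv₀, map_neg, map_neg]

omit hv₀S hv₀ in
-- Otherwise `φe` would be orthogonal to `TM`, hence `φe = c e`, and `φ²e = -e` would force `c² =
-- -1`.
theorem exists_screen_inner_ne_zero : ∃ z ∈ S p,
    s.metric.inner (f p) (mfderiv I J f p z) (s.φ (f p) (mfderiv I J f p e)) ≠ 0 := by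
  by_contra! hcon
  have hu : ∀ w, s.metric.inner (f p) (s.φ (f p) (mfderiv I J f p e)) (mfderiv I J f p w) = 0 := by
    intro w
    obtain ⟨c, y, hy, rfl⟩ := exists_eq_smul_add_screen hf hS he he0 w
    rw [s.metric.symm, map_add, map_smul, map_add, map_smul, add_apply, smul_apply, inner_φ_self,
      smul_zero, zero_add]
    exact hcon y hy
  obtain ⟨c, hc⟩ := exists_eq_smul_of_orthogonal hf he he0 hu
  have h := hchar.φ_φ_radical he
  rw [hc, map_smul, hc, smul_smul] at h
  have h2 : (c * c + 1) • mfderiv I J f p e = 0 := by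
    rw [add_smul, h, one_smul, neg_add_cancel]
  rcases smul_eq_zero.1 h2 with h3 | h3
  · nlinarith [mul_self_nonneg c]
  · exact he0 (hf.injective_mfderiv p (by rw [h3, map_zero]))

end IsCharacteristic

end Characteristic

/-! ### The local second fundamental form as a symmetric bilinear form. -/

section RadicalForm

variable {g : SemiRiemannianMetric J N}
  {cov : CovariantDerivative J F (TangentSpace J : N → Type _)} {f : M → N}
  {e : Π p : M, TangentSpace I p} {p : M}

theorem covAlong_add_vec (Z : Π p : M, TangentSpace J (f p)) (v w : TangentSpace I p) :
    covAlong I cov f Z p (v + w) = covAlong I cov f Z p v + covAlong I cov f Z p w := by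
  simp only [covAlong_eq, map_add]
  abel

theorem covAlong_smul_vec (Z : Π p : M, TangentSpace J (f p)) (a : ℝ) (v : TangentSpace I p) :
    covAlong I cov f Z p (a • v) = a • covAlong I cov f Z p v := by
  simp only [covAlong_eq, map_smul, smul_add]

variable (g cov f e p) in
/-- The local second fundamental form `(x, y) ↦ -g(∇_x e, y)` of a lightlike hypersurface, as a
form on the tangent space. -/
def radForm (x y : TangentSpace I p) : ℝ :=
  -g.inner (f p) (mfderiv I J f p y) (covAlong I cov f (fun q => mfderiv I J f q (e q)) p x)

theorem radForm_add_left (x x' y : TangentSpace I p) :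
    radForm g cov f e p (x + x') y = radForm g cov f e p x y + radForm g cov f e p x' y := by
  simp only [radForm, covAlong_add_vec, map_add, neg_add]

theorem radForm_smul_left (a : ℝ) (x y : TangentSpace I p) :
    radForm g cov f e p (a • x) y = a * radForm g cov f e p x y := by
  simp only [radForm, covAlong_smul_vec, map_smul, smul_eq_mul, mul_neg]

theorem radForm_add_right (x y y' : TangentSpace I p) :
    radForm g cov f e p x (y + y') = radForm g cov f e p x y + radForm g cov f e p x y' := by
  simp only [radForm, map_add, add_apply, neg_add]

theorem radForm_smul_right (a : ℝ) (x y : TangentSpace I p) :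
    radForm g cov f e p x (a • y) = a * radForm g cov f e p x y := by
  simp only [radForm, map_smul, smul_apply, smul_eq_mul, mul_neg]

variable (h : IsLeviCivita g cov) (hf : IsLightlikeHypersurface I g f)
  (he : SmoothFieldAt I e p) (hrad : ∀ᶠ q in 𝓝 p, e q ∈ radical I g f q)
include h hf he hrad

/-- Differentiate `g(Y, E) = 0`. The right side needs only the value of `Y` at `p`, so `B` is
tensorial. -/
theorem inner_covAlong_radical {Y : Π p : M, TangentSpace I p} (hY : SmoothFieldAt I Y p)
    (x : TangentSpace I p) :
    g.inner (f p) (covAlong I cov f (fun q => mfderiv I J f q (Y q)) p x) (mfderiv I J f p (e p))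
      = radForm g cov f e p x (Y p) := by
  have h1 := h.mvfderiv_inner_along (hf.smooth p) (hY.map_mfderiv hf.smooth)
    (he.map_mfderiv hf.smooth) x
  have h2 : mvfderiv I (fun q => g.inner (f q) (mfderiv I J f q (Y q))
      (mfderiv I J f q (e q))) p = mvfderiv I (fun _ => (0 : ℝ)) p := by
    apply mvfderiv_congr
    filter_upwards [hrad] with q hq
    exact inner_mfderiv_radical hq (Y q)
  rw [h2, mvfderiv_const, zero_apply] at h1
  rw [radForm]
  linarith

theorem localSecondFundamentalForm_eq_radForm {S : Π p : M, Submodule ℝ (TangentSpace I p)}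
    (hS : IsScreen I g f S) (X : Π p : M, TangentSpace I p) {Y : Π p : M, TangentSpace I p}
    (hY : SmoothFieldAt I Y p) :
    localSecondFundamentalForm I g cov f S e X Y p = radForm g cov f e p (X p) (Y p) := by
  rw [localSecondFundamentalForm, secondFundamentalForm,
    inner_ltrComponent hf hS hrad.self_of_nhds, inner_covAlong_radical h hf he hrad hY]

/-- The antisymmetric part is `g([X, Y], E)`, which vanishes because the bracket is tangent to `M`.
-/
theorem radForm_symm (x y : TangentSpace I p) :
    radForm g cov f e p x y = radForm g cov f e p y x := by
  have hx := smoothFieldAt_extend (J := I) x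
  have hy := smoothFieldAt_extend (J := I) y
  have h1 := inner_covAlong_radical h hf he hrad hy x
  have h2 := inner_covAlong_radical h hf he hrad hx y
  have h3 := h.torsion_free_along hf.smooth hx hy
  simp only [FiberBundle.extend_apply_self] at h1 h2 h3
  have h4 := congrArg (fun w => g.inner (f p) w (mfderiv I J f p (e p))) h3
  simp only [map_sub, sub_apply, h1, h2,
    inner_mfderiv_radical hrad.self_of_nhds] at h4
  linarith

/-- By symmetry this is `-g(E, ∇_x E)`, half the derivative of the constant `-g(E, E) = 0`. -/
theorem radForm_radical_left (x : TangentSpace I p) : radForm g cov f e p (e p) x = 0 := by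
  rw [radForm_symm h hf he hrad, radForm]
  have h1 := inner_covAlong_radical h hf he hrad he x
  rw [radForm, g.symm] at h1
  linarith

theorem radForm_radical_right (x : TangentSpace I p) : radForm g cov f e p x (e p) = 0 := by
  rw [radForm_symm h hf he hrad, radForm_radical_left h hf he hrad]

end RadicalForm

/-! ### The bracket identity. -/

section Bracket

variable {r : ℕ} {s : IndefiniteMetricGFF J N r}
  {cov : CovariantDerivative J F (TangentSpace J : N → Type _)} {f : M → N}
  {S : Π p : M, Submodule ℝ (TangentSpace I p)}
  {e : Π p : M, TangentSpace I p} {p : M}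

theorem IsCharacteristic.inner_mfderiv_mlieBracket [T2Space N] (hr : 0 < r) (hs : s.IsSManifold)
    (h : IsLeviCivita s.metric cov)
    (hf : IsLightlikeHypersurface I s.metric f) (hchar : IsCharacteristic I s f S)
    (he : SmoothFieldAt I e p) (hrad : ∀ᶠ q in 𝓝 p, e q ∈ radical I s.metric f q)
    {X Y : Π p : M, TangentSpace I p} (hX : SmoothFieldAt I X p) (hY : SmoothFieldAt I Y p)
    (hXφ : ∀ᶠ q in 𝓝 p, s.metric.inner (f q) (mfderiv I J f q (X q))
      (s.φ (f q) (mfderiv I J f q (e q))) = 0)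
    (hYφ : ∀ᶠ q in 𝓝 p, s.metric.inner (f q) (mfderiv I J f q (Y q))
      (s.φ (f q) (mfderiv I J f q (e q))) = 0)
    {x y : TangentSpace I p} (hx : mfderiv I J f p x = s.φ (f p) (mfderiv I J f p (X p)))
    (hy : mfderiv I J f p y = s.φ (f p) (mfderiv I J f p (Y p))) :
    s.metric.inner (f p) (mfderiv I J f p (mlieBracket I X Y p))
        (s.φ (f p) (mfderiv I J f p (e p)))
      = radForm s.metric cov f e p (Y p) x - radForm s.metric cov f e p (X p) y := by
  have hep := hrad.self_of_nhds
  -- Differentiate `g(φY, E) = 0` along `X`, with `∇_X(φY) = φ∇_X Y + (∇_X φ)Y`.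
  have key : ∀ (X Y : Π p : M, TangentSpace I p) (y : TangentSpace I p), SmoothFieldAt I X p →
      SmoothFieldAt I Y p → (∀ᶠ q in 𝓝 p, s.metric.inner (f q) (mfderiv I J f q (Y q))
      (s.φ (f q) (mfderiv I J f q (e q))) = 0) →
      mfderiv I J f p y = s.φ (f p) (mfderiv I J f p (Y p)) →
      s.metric.inner (f p) (s.φ (f p) (covAlong I cov f (fun q => mfderiv I J f q (Y q)) p (X p)))
        (mfderiv I J f p (e p)) = radForm s.metric cov f e p (X p) y
          - s.nablaPhi cov (f p) (mfderiv I J f p (X p)) (mfderiv I J f p (Y p))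
            (mfderiv I J f p (e p)) := by
    intro X Y y hX hY hYφ hy
    have hdY := hY.map_mfderiv hf.smooth
    have h1 := h.mvfderiv_inner_along (hf.smooth p) (hdY.clm_apply s.φ_smooth (hf.smooth p))
      (he.map_mfderiv hf.smooth) (X p)
    have h2 : mvfderiv I (fun q => s.metric.inner (f q) (s.φ (f q) (mfderiv I J f q (Y q)))
        (mfderiv I J f q (e q))) p = mvfderiv I (fun _ => (0 : ℝ)) p := by
      apply mvfderiv_congr
      filter_upwards [hYφ] with q hq
      rw [s.inner_φ_left, hq, neg_zero]
    rw [h2, mvfderiv_const, zero_apply, covAlong_clm_apply cov s.φ_smooth (hf.smooth p) hdY,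
      ← hy, map_add, add_apply] at h1
    rw [radForm, IndefiniteMetricGFF.nablaPhi]
    linarith
  have k1 := key X Y y hX hY hYφ hy
  have k2 := key Y X x hY hX hXφ hx
  have ht := h.torsion_free_along hf.smooth hX hY
  have c1 := s.inner_φ_left (f p) (mfderiv I J f p (mlieBracket I X Y p)) (mfderiv I J f p (e p))
  rw [← ht, map_sub, map_sub, sub_apply, k1, k2] at c1
  rw [← ht]
  -- Closedness and skewness reduce the difference of the two `∇φ` terms to `-T(E, X, Y)`, which
  -- `c4` kills.
  have c2 := IndefiniteMetricGFF.nablaPhi_cyclic hr hs h (f p) (mfderiv I J f p (X p))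
    (mfderiv I J f p (Y p)) (mfderiv I J f p (e p))
  have c3 := IndefiniteMetricGFF.nablaPhi_skew h (f p) (mfderiv I J f p (Y p))
    (mfderiv I J f p (e p)) (mfderiv I J f p (X p))
  have c4 := IndefiniteMetricGFF.nablaPhi_eq_zero hr hs h (f p) (mfderiv I J f p (e p))
    (mfderiv I J f p (X p)) (mfderiv I J f p (Y p)) (fun α => hchar.η_radical hep α)
    (hep _) (hep _)
  linarith

end Bracket

/-! ### Smooth coefficients with respect to frames. -/

section Frame

/-- Let `W q` be the map with columns `w i q` and `A` a left inverse at `p`. Near `p`, `A W q` is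
invertible, and `(A W q)⁻¹ A` is a left inverse depending smoothly on `q`. -/
theorem exists_smooth_leftInverse {ι : Type*} [Fintype ι] {w : ι → M → F} {p : M}
    (hw : ∀ i, ContMDiffAt I 𝓘(ℝ, F) ∞ (w i) p) (hli : LinearIndependent ℝ (fun i => w i p)) :
    ∃ L : M → F →L[ℝ] (ι → ℝ), ContMDiffAt I 𝓘(ℝ, F →L[ℝ] (ι → ℝ)) ∞ L p ∧
      ∀ᶠ q in 𝓝 p, ∀ a : ι → ℝ, L q (∑ i, a i • w i q) = a := by
  classical
  let W : M → (ι → ℝ) →L[ℝ] F := fun q =>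
    ∑ i, ContinuousLinearMap.smulRightL ℝ (ι → ℝ) F (ContinuousLinearMap.proj i) (w i q)
  have hWa : ∀ q a, W q a = ∑ i, a i • w i q := by
    intro q a
    simp [W, sum_apply]
  have hW : ContMDiffAt I 𝓘(ℝ, (ι → ℝ) →L[ℝ] F) ∞ W p := by
    refine ContMDiffAt.sum fun i _ => ?_
    exact (ContinuousLinearMap.contMDiff _).contMDiffAt.comp p (hw i)
  have hinj : LinearMap.ker (W p : (ι → ℝ) →ₗ[ℝ] F) = ⊥ := by
    rw [LinearMap.ker_eq_bot']
    intro a ha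
    have := hWa p a
    rw [show W p a = 0 from ha] at this
    funext i
    exact Fintype.linearIndependent_iff.1 hli a this.symm i
  obtain ⟨A, hA⟩ := LinearMap.exists_leftInverse_of_injective _ hinj
  let A' : F →L[ℝ] (ι → ℝ) := LinearMap.toContinuousLinearMap A
  let R : M → (ι → ℝ) →L[ℝ] (ι → ℝ) := fun q => A' ∘L W q
  have hR : ContMDiffAt I 𝓘(ℝ, (ι → ℝ) →L[ℝ] (ι → ℝ)) ∞ R p :=
    ContMDiffAt.clm_comp contMDiffAt_const hW
  have hRp : R p = 1 := by
    ext a i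
    exact congrFun (LinearMap.congr_fun hA a) i
  have hinvs : ContMDiffAt I 𝓘(ℝ, (ι → ℝ) →L[ℝ] (ι → ℝ)) ∞ (fun q => Ring.inverse (R q)) p := by
    have h1 : ContDiffAt ℝ ∞ (Ring.inverse : ((ι → ℝ) →L[ℝ] (ι → ℝ)) → _) (R p) := by
      rw [hRp]
      exact contDiffAt_ringInverse ℝ (1 : ((ι → ℝ) →L[ℝ] (ι → ℝ))ˣ)
    exact h1.contMDiffAt.comp p hR
  refine ⟨fun q => Ring.inverse (R q) ∘L A', hinvs.clm_comp contMDiffAt_const, ?_⟩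
  have hu : ∀ᶠ q in 𝓝 p, IsUnit (R q) := by
    have := Units.nhds (1 : ((ι → ℝ) →L[ℝ] (ι → ℝ))ˣ)
    refine hR.continuousAt.eventually ?_
    rw [hRp]
    exact this
  filter_upwards [hu] with q hq a
  rw [← hWa]
  have := congrArg (fun B => B a) (Ring.inverse_mul_cancel _ hq)
  exact this

/-- Coefficients with respect to a smooth frame along a map are smooth. -/
theorem contMDiffAt_frame_coefficients {ι : Type*} [Fintype ι] {f : M → N} {p : M}
    (hf : ContMDiffAt I J ∞ f p)
    {w : ι → Π p : M, TangentSpace J (f p)} (hw : ∀ i, SmoothAlongAt I J f (w i) p)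
    (hli : LinearIndependent ℝ (fun i => w i p)) {c : ι → M → ℝ}
    (hc : SmoothAlongAt I J f (fun q => ∑ i, c i q • w i q) p) (i : ι) :
    ContMDiffAt I 𝓘(ℝ, ℝ) ∞ (c i) p := by
  set t := trivializationAt F (TangentSpace J : N → Type _) (f p) with ht
  have hb : ∀ᶠ q in 𝓝 p, f q ∈ t.baseSet := hf.continuousAt.eventually
    (t.open_baseSet.mem_nhds (FiberBundle.mem_baseSet_trivializationAt' (f p)))
  have hli' : LinearIndependent ℝ (fun i => (t ⟨f p, w i p⟩).2) := by
    have h1 := hli.map' (t.continuousLinearEquivAt ℝ (f p) hb.self_of_nhds :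
      TangentSpace J (f p) →ₗ[ℝ] F) (LinearEquiv.ker _)
    exact h1
  obtain ⟨L, hL, hLa⟩ := exists_smooth_leftInverse (fun i => (smoothAlongAt_iff hf).1 (hw i)) hli'
  have h1 := hL.clm_apply ((smoothAlongAt_iff hf).1 hc)
  have h2 : ContMDiffAt I 𝓘(ℝ, ι → ℝ) ∞ (fun q i => c i q) p := by
    refine h1.congr_of_eventuallyEq ?_
    filter_upwards [hb, hLa] with q hq hq2
    rw [← hq2 (fun i => c i q)]
    congr 1
    have h3 := map_sum (t.continuousLinearEquivAt ℝ (f q) hq) (fun i => c i q • w i q)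
      Finset.univ
    simp only [map_smul] at h3
    exact h3.symm
  exact contMDiffAt_pi_space.1 h2 i

end Frame

/-! ### Smoothness of radical and screen components. -/

section Screen

variable {g : SemiRiemannianMetric J N} {f : M → N}
  {S : Π p : M, Submodule ℝ (TangentSpace I p)} {e : Π p : M, TangentSpace I p} {p : M}

theorem smoothFieldAt_congr {X Y : Π p : M, TangentSpace I p} (hX : SmoothFieldAt I X p)
    (h : ∀ᶠ q in 𝓝 p, Y q = X q) : SmoothFieldAt I Y p :=
  SmoothAlongAt.congr (f := id) (J := I) hX h

theorem SmoothAlongAt.sum {ι : Type*} (A : Finset ι) (hf : ContMDiffAt I J ∞ f p)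
    {Z : ι → Π p : M, TangentSpace J (f p)} (hZ : ∀ i, SmoothAlongAt I J f (Z i) p) :
    SmoothAlongAt I J f (fun q => ∑ i ∈ A, Z i q) p := by
  classical
  induction A using Finset.induction_on with
  | empty =>
    simp only [Finset.sum_empty]
    have h0 := SmoothFieldAt.comp hf (smoothFieldAt_extend (J := J) (0 : TangentSpace J (f p)))
    exact (SmoothAlongAt.smul hf (contMDiffAt_const (c := (0 : ℝ))) h0).congr
      (Filter.Eventually.of_forall fun q => (zero_smul ℝ _).symm)
  | insert i A hi ih =>
    simp only [Finset.sum_insert hi]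
    exact (hZ i).add hf ih

theorem smoothFieldAt_sum_smul {ι : Type*} [Fintype ι] {X : ι → Π p : M, TangentSpace I p}
    {c : ι → M → ℝ} (hc : ∀ i, ContMDiffAt I 𝓘(ℝ, ℝ) ∞ (c i) p)
    (hX : ∀ i, SmoothFieldAt I (X i) p) : SmoothFieldAt I (fun q => ∑ i, c i q • X i q) p :=
  SmoothAlongAt.sum (f := id) (J := I) Finset.univ contMDiffAt_id fun i =>
    SmoothAlongAt.smul contMDiffAt_id (hc i) (hX i)

/-- The components of a smooth tangent field with respect to the radical and the screen
distribution are smooth. -/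
theorem smooth_radical_screen_components (hf : IsLightlikeHypersurface I g f)
    (hS : IsScreen I g f S) (he : SmoothFieldAt I e p) (hrad : e p ∈ radical I g f p)
    (he0 : e p ≠ 0) {Z : Π p : M, TangentSpace J (f p)} (hZ : SmoothAlongAt I J f Z p)
    {θ : M → ℝ} {y : Π p : M, TangentSpace I p}
    (hy : ∀ᶠ q in 𝓝 p, y q ∈ S q ∧ mfderiv I J f q (θ q • e q + y q) = Z q) :
    ContMDiffAt I 𝓘(ℝ, ℝ) ∞ θ p ∧ SmoothFieldAt I y p := by
  classical
  obtain ⟨k, hk⟩ := hS.smooth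
  obtain ⟨U, hU, hpU, t, ht, htU⟩ := hk p
  have htp : ∀ i, SmoothFieldAt I (t i) p := fun i => (ht i).contMDiffAt (hU.mem_nhds hpU)
  have hex : ∀ q, ∃ a : Fin k → ℝ, q ∈ U → y q ∈ S q → ∑ i, a i • t i q = y q := by
    intro q
    by_cases h : q ∈ U ∧ y q ∈ S q
    · have h1 := h.2
      rw [← (htU q h.1).2, Submodule.mem_span_range_iff_exists_fun] at h1
      obtain ⟨a, ha⟩ := h1
      exact ⟨a, fun _ _ => ha⟩
    · exact ⟨0, fun h1 h2 => absurd ⟨h1, h2⟩ h⟩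
  choose a ha using hex
  -- A local frame of `TM`: `none` indexes the radical field, `some i` the screen frame.
  let w : Option (Fin k) → Π p : M, TangentSpace I p := fun i => i.elim e t
  let c : Option (Fin k) → M → ℝ := fun i q => i.elim (θ q) (a q)
  have hw : ∀ i, SmoothAlongAt I J f (fun q => mfderiv I J f q (w i q)) p := by
    rintro (_ | i)
    · exact he.map_mfderiv hf.smooth
    · exact (htp i).map_mfderiv hf.smooth
  have hli : LinearIndependent ℝ (fun i => mfderiv I J f p (w i p)) := by
    have h1 : LinearIndependent ℝ (fun i => w i p) := by
      rw [linearIndependent_option]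
      refine ⟨(htU p hpU).1, fun h => he0 ?_⟩
      have h2 : e p ∈ S p := by rw [← (htU p hpU).2]; exact h
      exact Submodule.disjoint_def.1 (hS.isCompl p).disjoint _ hrad h2
    exact h1.map' (mfderiv I J f p : TangentSpace I p →ₗ[ℝ] TangentSpace J (f p))
      (LinearMap.ker_eq_bot.2 (hf.injective_mfderiv p))
  have hc : SmoothAlongAt I J f (fun q => ∑ i, c i q • mfderiv I J f q (w i q)) p := by
    refine hZ.congr ?_
    filter_upwards [hy, hU.mem_nhds hpU] with q hq hqU
    rw [← hq.2, ← ha q hqU hq.1]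
    simp [Fintype.sum_option, c, w]
  have hcs := contMDiffAt_frame_coefficients (hf.smooth p) hw hli hc
  refine ⟨hcs none, ?_⟩
  refine smoothFieldAt_congr (smoothFieldAt_sum_smul (fun i => hcs (some i)) htp) ?_
  filter_upwards [hy, hU.mem_nhds hpU] with q hq hqU
  exact (ha q hqU hq.1).symm

theorem SmoothAlongAt.pull (hf : IsLightlikeHypersurface I g f)
    (hS : IsScreen I g f S) (he : SmoothFieldAt I e p) (hrad : ∀ᶠ q in 𝓝 p, e q ∈ radical I g f q)
    (he0 : ∀ᶠ q in 𝓝 p, e q ≠ 0) {Z : Π p : M, TangentSpace J (f p)}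
    (hZ : SmoothAlongAt I J f Z p) (hT : ∀ᶠ q in 𝓝 p, Z q ∈ tangentImage I J f q) :
    SmoothFieldAt I (fun q => pull I f q (Z q)) p := by
  have hex : ∀ q, ∃ (c : ℝ) (y : TangentSpace I q), e q ∈ radical I g f q → e q ≠ 0 →
      y ∈ S q ∧ LightlikeGeometry.pull I f q (Z q) = c • e q + y := by
    intro q
    by_cases h : e q ∈ radical I g f q ∧ e q ≠ 0
    · obtain ⟨c, y, hy, h1⟩ := exists_eq_smul_add_screen hf hS h.1 h.2
        (LightlikeGeometry.pull I f q (Z q))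
      exact ⟨c, y, fun _ _ => ⟨hy, h1⟩⟩
    · exact ⟨0, 0, fun h1 h2 => absurd ⟨h1, h2⟩ h⟩
  choose c y hcy using hex
  obtain ⟨h1, h2⟩ := smooth_radical_screen_components hf hS he hrad.self_of_nhds he0.self_of_nhds
    hZ (θ := c) (y := y) (by
      filter_upwards [hrad, he0, hT] with q h1 h2 h3
      exact ⟨(hcy q h1 h2).1, by rw [← (hcy q h1 h2).2, mfderiv_pull h3]⟩)
  refine smoothFieldAt_congr ((SmoothFieldAt.smul h1 he).add h2) ?_
  filter_upwards [hrad, he0] with q h1 h2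
  exact (hcy q h1 h2).2

theorem IsScreen.exists_smooth_extension (hS : IsScreen I g f S) {x : TangentSpace I p}
    (hx : x ∈ S p) : ∃ (X : Π p : M, TangentSpace I p) (U : Set M), IsOpen U ∧ p ∈ U ∧
      (∀ q ∈ U, SmoothFieldAt I X q) ∧ (∀ q ∈ U, X q ∈ S q) ∧ X p = x := by
  obtain ⟨k, hk⟩ := hS.smooth
  obtain ⟨U, hU, hpU, t, ht, htU⟩ := hk p
  rw [← (htU p hpU).2, Submodule.mem_span_range_iff_exists_fun] at hx
  obtain ⟨a, ha⟩ := hx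
  refine ⟨fun q => ∑ i, a i • t i q, U, hU, hpU, fun q hq => ?_, fun q hq => ?_, ha⟩
  · exact smoothFieldAt_sum_smul (c := fun i _ => a i) (fun i => contMDiffAt_const)
      (fun i => (ht i).contMDiffAt (hU.mem_nhds hq))
  · rw [← (htU q hq).2]
    exact Submodule.sum_mem _ fun i _ => Submodule.smul_mem _ _ (Submodule.subset_span ⟨i, rfl⟩)

end Screen

/-! ### Smooth sections of `D₀` through a given vector. -/

section Extension

variable {r : ℕ} {s : IndefiniteMetricGFF J N r} {f : M → N}
  {S : Π p : M, Submodule ℝ (TangentSpace I p)} {e : Π p : M, TangentSpace I p}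

theorem IsCharacteristic.mfderiv_phiField_radical (hchar : IsCharacteristic I s f S) {p : M}
    (hrad : e p ∈ radical I s.metric f p) :
    mfderiv I J f p (phiField I s f e p) = s.φ (f p) (mfderiv I J f p (e p)) := by
  obtain ⟨v, -, hv⟩ := hchar.exists_screen_eq_φ_radical hrad
  exact mfderiv_pull ⟨v, hv⟩

theorem IsCharacteristic.phiField_radical_mem (hf : IsLightlikeHypersurface I s.metric f)
    (hchar : IsCharacteristic I s f S) {p : M}
    (hrad : e p ∈ radical I s.metric f p) : phiField I s f e p ∈ S p := by
  obtain ⟨v, hvS, hv⟩ := hchar.exists_screen_eq_φ_radical hrad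
  have := hf.injective_mfderiv p ((hchar.mfderiv_phiField_radical hrad).trans hv.symm)
  rwa [this]

variable (hf : IsLightlikeHypersurface I s.metric f) (hS : IsScreen I s.metric f S)
  (hchar : IsCharacteristic I s f S) {W : Set M} (hW : IsOpen W)
  (he : ∀ q ∈ W, SmoothFieldAt I e q) (hrad : ∀ q ∈ W, e q ∈ radical I s.metric f q)
  (he0 : ∀ q ∈ W, e q ≠ 0)
include hf hS hchar hW he hrad he0

theorem IsCharacteristic.smoothFieldAt_phiField {X : Π p : M, TangentSpace I p} {p : M}
    (hp : p ∈ W) (hX : SmoothFieldAt I X p) (hT : ∀ᶠ q in 𝓝 p,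
      s.φ (f q) (mfderiv I J f q (X q)) ∈ tangentImage I J f q) :
    SmoothFieldAt I (phiField I s f X) p := by
  have hWp := hW.mem_nhds hp
  exact ((hX.map_mfderiv hf.smooth).clm_apply s.φ_smooth (hf.smooth p)).pull hf hS (he p hp)
    (Filter.mem_of_superset hWp hrad) (Filter.mem_of_superset hWp he0) hT

/-- Every vector of `D₀` extends to a smooth section of `D₀`. -/
theorem IsCharacteristic.exists_smooth_extension_distD₀ [T2Space M] {p : M} (hp : p ∈ W)
    {x : TangentSpace I p} (hx : x ∈ distD₀ I s f S p) :
    ∃ X : Π p : M, TangentSpace I p, (∀ q, SmoothFieldAt I X q) ∧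
      (∀ q, X q ∈ distD₀ I s f S q) ∧ X p = x := by
  obtain ⟨hxS, u, huS, hu⟩ := (mem_distD₀_iff hf hS hchar (hrad p hp) (he0 p hp) x).1 hx
  obtain ⟨z, hzS, hz⟩ := exists_screen_inner_ne_zero hf hS hchar (hrad p hp) (he0 p hp)
  obtain ⟨X, U₁, hU₁, hpU₁, hXs, hXS, rfl⟩ := hS.exists_smooth_extension hxS
  obtain ⟨Z, U₂, hU₂, hpU₂, hZs, hZS, rfl⟩ := hS.exists_smooth_extension hzS
  have hφe : ∀ q ∈ W, SmoothAlongAt I J f (fun q => s.φ (f q) (mfderiv I J f q (e q))) q :=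
    fun q hq => ((he q hq).map_mfderiv hf.smooth).clm_apply s.φ_smooth (hf.smooth q)
  let α : (Π p : M, TangentSpace I p) → M → ℝ := fun X q =>
    s.metric.inner (f q) (mfderiv I J f q (X q)) (s.φ (f q) (mfderiv I J f q (e q)))
  have hα : ∀ X : Π p : M, TangentSpace I p, ∀ q ∈ W, SmoothFieldAt I X q →
      ContMDiffAt I 𝓘(ℝ, ℝ) ∞ (α X) q := fun X q hq hX =>
    s.metric.contMDiffAt_inner (hf.smooth q) (hX.map_mfderiv hf.smooth) (hφe q hq)
  set W' : Set M := (W ∩ U₁ ∩ U₂) ∩ α Z ⁻¹' {0}ᶜ with hW'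
  have hW'o : IsOpen W' := by
    refine ContinuousOn.isOpen_inter_preimage (fun q hq => ?_) ((hW.inter hU₁).inter hU₂)
      isOpen_compl_singleton
    exact (hα Z q hq.1.1 (hZs q hq.2)).continuousAt.continuousWithinAt
  have hpW' : p ∈ W' := ⟨⟨⟨hp, hpU₁⟩, hpU₂⟩, hz⟩
  -- Subtracting `ρ • Z` makes the field orthogonal to `φE`, so that `φX₁` is tangent; `ρ` vanishes
  -- at `p` because `X p` is in `D₀`.
  let ρ : M → ℝ := fun q => α X q / α Z q
  let X₁ : Π p : M, TangentSpace I p := fun q => X q + (-ρ q) • Z q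
  have hX₁s : ∀ q ∈ W', SmoothFieldAt I X₁ q := by
    intro q hq
    have hρ : ContMDiffAt I 𝓘(ℝ, ℝ) ∞ (fun q => -ρ q) q :=
      ((hα X q hq.1.1.1 (hXs q hq.1.1.2)).div₀ (hα Z q hq.1.1.1 (hZs q hq.1.2)) hq.2).neg
    exact (hXs q hq.1.1.2).add (SmoothFieldAt.smul hρ (hZs q hq.1.2))
  have hX₁S : ∀ q ∈ W', X₁ q ∈ S q := fun q hq =>
    add_mem (hXS q hq.1.1.2) (Submodule.smul_mem _ _ (hZS q hq.1.2))
  have hX₁α : ∀ q ∈ W', α X₁ q = 0 := by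
    intro q hq
    have h1 : α X₁ q = α X q + (-ρ q) * α Z q := by
      simp only [α, X₁, map_add, map_smul, add_apply, smul_apply, smul_eq_mul]
    rw [h1, neg_mul, div_mul_cancel₀ _ hq.2, add_neg_cancel]
  have hX₁p : X₁ p = X p := by
    have h1 : α X p = 0 := hx.2 _ (Submodule.mem_sup_left ⟨_, ⟨_, hrad p hp, rfl⟩, rfl⟩)
    simp [X₁, ρ, h1]
  have hex : ∀ q, ∃ (c : ℝ) (y : TangentSpace I q), q ∈ W' → y ∈ S q ∧
      mfderiv I J f q (c • e q + y) = s.φ (f q) (mfderiv I J f q (X₁ q)) := by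
    intro q
    by_cases h : q ∈ W'
    · have hrq := hrad q h.1.1.1
      have heq := he0 q h.1.1.1
      obtain ⟨v, hv⟩ := (φ_mem_tangentImage_iff hf hS hchar hrq heq _).2 (hX₁α q h)
      obtain ⟨c, y, hy, rfl⟩ := exists_eq_smul_add_screen hf hS hrq heq v
      exact ⟨c, y, fun _ => ⟨hy, hv⟩⟩
    · exact ⟨0, 0, fun h1 => absurd h1 h⟩
  choose θ y hθy using hex
  have hθs : ∀ q ∈ W', ContMDiffAt I 𝓘(ℝ, ℝ) ∞ θ q := fun q hq =>
    (smooth_radical_screen_components hf hS (he q hq.1.1.1) (hrad q hq.1.1.1) (he0 q hq.1.1.1)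
      (((hX₁s q hq).map_mfderiv hf.smooth).clm_apply s.φ_smooth (hf.smooth q))
      (Filter.mem_of_superset (hW'o.mem_nhds hq) hθy)).1
  -- At `p` the vector `φ(X p)` already lies in the screen, so it has no radical component.
  have hθp : θ p = 0 := by
    obtain ⟨hyS, hy⟩ := hθy p hpW'
    rw [hX₁p, ← hu] at hy
    have h1 := hf.injective_mfderiv p hy
    have h2 : θ p • e p ∈ S p := by
      rw [eq_sub_of_add_eq h1]
      exact sub_mem huS hyS
    have h3 := Submodule.disjoint_def.1 (hS.isCompl p).disjoint _
      (Submodule.smul_mem _ (θ p) (hrad p hp)) h2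
    exact (smul_eq_zero.1 h3).resolve_right (he0 p hp)
  -- Since `φ(φE) = -E`, this correction removes the radical component `θ E` of `φX₁` and stays in
  -- the screen.
  let X₀ : Π p : M, TangentSpace I p := fun q => X₁ q + θ q • phiField I s f e q
  have hX₀s : ∀ q ∈ W', SmoothFieldAt I X₀ q := fun q hq =>
    (hX₁s q hq).add (SmoothFieldAt.smul (hθs q hq)
      (smoothFieldAt_phiField hf hS hchar hW he hrad he0 hq.1.1.1 (he q hq.1.1.1)
        (Filter.mem_of_superset (hW.mem_nhds hq.1.1.1) fun q' hq' =>
          ⟨_, hchar.mfderiv_phiField_radical (hrad q' hq')⟩)))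
  have hX₀D : ∀ q ∈ W', X₀ q ∈ distD₀ I s f S q := by
    intro q hq
    have hrq := hrad q hq.1.1.1
    obtain ⟨hyS, hy⟩ := hθy q hq
    refine (mem_distD₀_iff hf hS hchar hrq (he0 q hq.1.1.1) _).2
      ⟨add_mem (hX₁S q hq) (Submodule.smul_mem _ _ (hchar.phiField_radical_mem hf hrq)), y q, hyS,
        ?_⟩
    simp only [X₀, map_add, map_smul]
    rw [hchar.mfderiv_phiField_radical hrq, hchar.φ_φ_radical hrq, ← hy, map_add, map_smul,
      smul_neg]
    abel
  obtain ⟨ψ, h1, h2, h3⟩ := exists_smooth_cutoff hW'o hpW' hX₀s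
  refine ⟨ψ • X₀, h3, fun q => ?_, ?_⟩
  · by_cases hq : q ∈ W'
    · exact Submodule.smul_mem _ _ (hX₀D q hq)
    · change ψ q • X₀ q ∈ _
      rw [h2 q hq, zero_smul]
      exact zero_mem _
  · change ψ p • (X₁ p + θ p • _) = _
    rw [h1.self_of_nhds, one_smul, hθp, zero_smul, add_zero, hX₁p]

end Extension

/-! ### Equivalence on one open set. -/

section Integrability

variable {r : ℕ} {s : IndefiniteMetricGFF J N r}
  {cov : CovariantDerivative J F (TangentSpace J : N → Type _)} {f : M → N}
  {S : Π p : M, Submodule ℝ (TangentSpace I p)} {e : Π p : M, TangentSpace I p}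

theorem SmoothFieldAt.neg {X : Π p : M, TangentSpace I p} {p : M} (hX : SmoothFieldAt I X p) :
    SmoothFieldAt I (fun q => -X q) p :=
  smoothFieldAt_congr (SmoothFieldAt.smul (contMDiffAt_const (c := (-1 : ℝ))) hX)
    (Filter.Eventually.of_forall fun q => (neg_one_smul ℝ (X q)).symm)

variable [T2Space M] [T2Space N] (hr : 0 < r) (hs : s.IsSManifold)
  (h : IsLeviCivita s.metric cov)
  (hf : IsLightlikeHypersurface I s.metric f) (hS : IsScreen I s.metric f S)
  (hchar : IsCharacteristic I s f S) {W : Set M} (hW : IsOpen W)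
  (he : IsSmoothFieldOn I e W) (hrad : ∀ q ∈ W, e q ∈ radical I s.metric f q)
  (he0 : ∀ q ∈ W, e q ≠ 0)
include hr hs h hf hS hchar hW he hrad he0

theorem IsCharacteristic.bracket_mem_distD_iff {X Y : Π p : M, TangentSpace I p} {p : M}
    (hp : p ∈ W) (hX : SmoothFieldAt I X p) (hY : SmoothFieldAt I Y p)
    (hXD : ∀ᶠ q in 𝓝 p, X q ∈ distD I s f S q) (hYD : ∀ᶠ q in 𝓝 p, Y q ∈ distD I s f S q)
    {x y : TangentSpace I p} (hx : mfderiv I J f p x = s.φ (f p) (mfderiv I J f p (X p)))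
    (hy : mfderiv I J f p y = s.φ (f p) (mfderiv I J f p (Y p))) :
    mlieBracket I X Y p ∈ distD I s f S p ↔
      radForm s.metric cov f e p (X p) y = radForm s.metric cov f e p (Y p) x := by
  have hWp := hW.mem_nhds hp
  have hD : ∀ q ∈ W, ∀ z : TangentSpace I q, z ∈ distD I s f S q ↔
      s.metric.inner (f q) (mfderiv I J f q z) (s.φ (f q) (mfderiv I J f q (e q))) = 0 :=
    fun q hq z => mem_distD_iff hf hS hchar (hrad q hq) (he0 q hq)
      (neg_mem (hchar.phiField_radical_mem hf (hrad q hq)))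
      (by rw [map_neg, hchar.mfderiv_phiField_radical (hrad q hq)]) z
  rw [hD p hp, hchar.inner_mfderiv_mlieBracket hr hs h hf (he.contMDiffAt hWp)
    (Filter.mem_of_superset hWp hrad) hX hY ?_ ?_ hx hy, sub_eq_zero, eq_comm]
  · filter_upwards [hXD, hWp] with q h1 h2
    exact (hD q h2 _).1 h1
  · filter_upwards [hYD, hWp] with q h1 h2
    exact (hD q h2 _).1 h1

/-- The three conditions come from the brackets `[X, Y]`, `[X, E]` and `[V, E]`. In the last two,
`B(E, ·) = 0` reduces the bracket criterion to `B(X, φE) = 0` and `B(V, φE) = 0`. -/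
theorem IsCharacteristic.second_fundamental_form_of_integrable
    (hint : IsIntegrable I (distD I s f S)) :
    (∀ X Y : Π p : M, TangentSpace I p, IsSmoothFieldOn I X W → IsSmoothFieldOn I Y W →
      (∀ p ∈ W, X p ∈ distD₀ I s f S p) → (∀ p ∈ W, Y p ∈ distD₀ I s f S p) →
      ∀ p ∈ W, localSecondFundamentalForm I s.metric cov f S e X (phiField I s f Y) p
        = localSecondFundamentalForm I s.metric cov f S e (phiField I s f X) Y p) ∧
    (∀ X : Π p : M, TangentSpace I p, IsSmoothFieldOn I X W →
      (∀ p ∈ W, X p ∈ distD₀ I s f S p) → ∀ p ∈ W,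
        localSecondFundamentalForm I s.metric cov f S e X (fun q => -phiField I s f e q) p = 0) ∧
    ∀ p ∈ W, localSecondFundamentalForm I s.metric cov f S e (fun q => -phiField I s f e q)
      (fun q => -phiField I s f e q) p = 0 := by
  have he' : ∀ q ∈ W, SmoothFieldAt I e q := fun q hq => he.contMDiffAt (hW.mem_nhds hq)
  have hev : ∀ {P : M → Prop}, (∀ q ∈ W, P q) → ∀ q ∈ W, ∀ᶠ q' in 𝓝 q, P q' :=
    fun hP q hq => Filter.mem_of_superset (hW.mem_nhds hq) hP
  have hφ : ∀ X : Π p : M, TangentSpace I p, (∀ q ∈ W, X q ∈ distD₀ I s f S q) →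
      ∀ q ∈ W, mfderiv I J f q (phiField I s f X q) = s.φ (f q) (mfderiv I J f q (X q)) := by
    intro X hX q hq
    obtain ⟨u, -, hu⟩ := exists_φ_distD₀ hf hS hchar (hrad q hq) (he0 q hq) (hX q hq)
    exact mfderiv_pull ⟨u, hu⟩
  have hφs : ∀ X : Π p : M, TangentSpace I p, IsSmoothFieldOn I X W →
      (∀ q ∈ W, X q ∈ distD₀ I s f S q) → ∀ q ∈ W, SmoothFieldAt I (phiField I s f X) q :=
    fun X hXs hX q hq => smoothFieldAt_phiField hf hS hchar hW he' hrad he0 hq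
      (hXs.contMDiffAt (hW.mem_nhds hq)) (hev (fun q hq => ⟨_, hφ X hX q hq⟩) q hq)
  have hφe := fun q hq => hchar.mfderiv_phiField_radical (hrad q hq)
  have hVs : ∀ q ∈ W, SmoothFieldAt I (fun q => -phiField I s f e q) q := fun q hq =>
    (smoothFieldAt_phiField hf hS hchar hW he' hrad he0 hq (he' q hq)
      (hev (fun q hq => ⟨_, hφe q hq⟩) q hq)).neg
  have hD₀D : ∀ q, distD₀ I s f S q ≤ distD I s f S q := fun q =>
    le_sup_of_le_left le_sup_left
  have heD : ∀ q ∈ W, e q ∈ distD I s f S q := fun q hq => Submodule.mem_sup_right (hrad q hq)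
  have hVD : ∀ q ∈ W, -phiField I s f e q ∈ distD I s f S q := fun q hq => by
    refine neg_mem (Submodule.mem_sup_left (Submodule.mem_sup_right ?_))
    exact ⟨_, ⟨_, hrad q hq, rfl⟩, (hφe q hq).symm⟩
  have hB : ∀ q ∈ W, ∀ X Y : Π p : M, TangentSpace I p, SmoothFieldAt I Y q →
      localSecondFundamentalForm I s.metric cov f S e X Y q
        = radForm s.metric cov f e q (X q) (Y q) := fun q hq X Y hY =>
    localSecondFundamentalForm_eq_radForm h hf (he' q hq) (hev hrad q hq) hS X hY
  have hVφ : ∀ q ∈ W, mfderiv I J f q (e q)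
      = s.φ (f q) (mfderiv I J f q (-phiField I s f e q)) := by
    intro q hq
    rw [map_neg, hφe q hq, map_neg, hchar.φ_φ_radical (hrad q hq), neg_neg]
  have hbe := fun q hq => radForm_radical_left h hf (he' q hq) (hev hrad q hq)
  -- the bracket of a section of `D` with the radical field
  have hbr : ∀ X : Π p : M, TangentSpace I p, ∀ q ∈ W, IsSmoothFieldOn I X W →
      (∀ q ∈ W, X q ∈ distD I s f S q) → ∀ x, mfderiv I J f q x
        = s.φ (f q) (mfderiv I J f q (X q)) →
      radForm s.metric cov f e q (X q) (-phiField I s f e q) = 0 := by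
    intro X q hq hX hXD x hx
    have h1 := (bracket_mem_distD_iff hr hs h hf hS hchar hW he hrad he0 hq
      (hX.contMDiffAt (hW.mem_nhds hq)) (he' q hq) (hev hXD q hq) (hev heD q hq) hx (hφe q hq)).1
      (hint W hW X e hX he hXD heD q hq)
    rw [hbe q hq] at h1
    rw [← neg_one_smul ℝ, radForm_smul_right, h1, mul_zero]
  refine ⟨fun X Y hX hY hXD hYD p hp => ?_, fun X hX hXD p hp => ?_, fun p hp => ?_⟩
  · have hYp := hY.contMDiffAt (hW.mem_nhds hp)
    rw [hB p hp X _ (hφs Y hY hYD p hp), hB p hp _ Y hYp,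
      radForm_symm h hf (he' p hp) (hev hrad p hp) (phiField I s f X p)]
    exact (bracket_mem_distD_iff hr hs h hf hS hchar hW he hrad he0 hp
      (hX.contMDiffAt (hW.mem_nhds hp)) hYp (hev (fun q hq => hD₀D q (hXD q hq)) p hp)
      (hev (fun q hq => hD₀D q (hYD q hq)) p hp) (hφ X hXD p hp) (hφ Y hYD p hp)).1
      (hint W hW X Y hX hY (fun q hq => hD₀D q (hXD q hq)) (fun q hq => hD₀D q (hYD q hq)) p hp)
  · rw [hB p hp X _ (hVs p hp)]
    exact hbr X p hp hX (fun q hq => hD₀D q (hXD q hq)) _ (hφ X hXD p hp)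
  · rw [hB p hp _ _ (hVs p hp)]
    exact hbr _ p hp (fun q hq => (hVs q hq).contMDiffWithinAt) hVD _ (hVφ p hp)

theorem IsCharacteristic.mlieBracket_mem_distD
    (ha : ∀ X Y : Π p : M, TangentSpace I p, IsSmoothFieldOn I X W → IsSmoothFieldOn I Y W →
      (∀ p ∈ W, X p ∈ distD₀ I s f S p) → (∀ p ∈ W, Y p ∈ distD₀ I s f S p) →
      ∀ p ∈ W, localSecondFundamentalForm I s.metric cov f S e X (phiField I s f Y) p
        = localSecondFundamentalForm I s.metric cov f S e (phiField I s f X) Y p)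
    (hb : ∀ X : Π p : M, TangentSpace I p, IsSmoothFieldOn I X W →
      (∀ p ∈ W, X p ∈ distD₀ I s f S p) → ∀ p ∈ W,
        localSecondFundamentalForm I s.metric cov f S e X (fun q => -phiField I s f e q) p = 0)
    (hc : ∀ p ∈ W, localSecondFundamentalForm I s.metric cov f S e
      (fun q => -phiField I s f e q) (fun q => -phiField I s f e q) p = 0)
    {X Y : Π p : M, TangentSpace I p} {p : M} (hp : p ∈ W) (hX : SmoothFieldAt I X p)
    (hY : SmoothFieldAt I Y p) (hXD : ∀ᶠ q in 𝓝 p, X q ∈ distD I s f S q)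
    (hYD : ∀ᶠ q in 𝓝 p, Y q ∈ distD I s f S q) :
    mlieBracket I X Y p ∈ distD I s f S p := by
  have he' : ∀ q ∈ W, SmoothFieldAt I e q := fun q hq => he.contMDiffAt (hW.mem_nhds hq)
  have hev : ∀ {P : M → Prop}, (∀ q ∈ W, P q) → ∀ᶠ q' in 𝓝 p, P q' :=
    fun hP => Filter.mem_of_superset (hW.mem_nhds hp) hP
  have hrp := hrad p hp
  have hep := he0 p hp
  set b := radForm s.metric cov f e p with hbd
  set v : TangentSpace I p := -phiField I s f e p with hv
  have hφe := fun q hq => hchar.mfderiv_phiField_radical (hrad q hq)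
  have hvS : v ∈ S p := neg_mem (hchar.phiField_radical_mem hf hrp)
  have hve : mfderiv I J f p v = -s.φ (f p) (mfderiv I J f p (e p)) := by
    rw [hv, map_neg, hφe p hp]
  have hφv : s.φ (f p) (mfderiv I J f p v) = mfderiv I J f p (e p) := by
    rw [hve, map_neg, hchar.φ_φ_radical hrp, neg_neg]
  have hVs : SmoothFieldAt I (fun q => -phiField I s f e q) p :=
    (smoothFieldAt_phiField hf hS hchar hW he' hrad he0 hp (he' p hp)
      (hev (fun q hq => ⟨_, hφe q hq⟩))).neg
  have hB : ∀ X Y : Π p : M, TangentSpace I p, SmoothFieldAt I Y p →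
      localSecondFundamentalForm I s.metric cov f S e X Y p = b (X p) (Y p) := fun X Y hY =>
    localSecondFundamentalForm_eq_radForm h hf (he' p hp) (hev hrad) hS X hY
  have hsymm := radForm_symm h hf (he' p hp) (hev hrad)
  -- The conditions on fields become conditions on vectors at `p` by extending within `D₀`.
  have pa : ∀ x ∈ distD₀ I s f S p, ∀ y ∈ distD₀ I s f S p, ∀ x' y' : TangentSpace I p,
      mfderiv I J f p x' = s.φ (f p) (mfderiv I J f p x) →
      mfderiv I J f p y' = s.φ (f p) (mfderiv I J f p y) → b x y' = b y x' := by
    intro x hx y hy x' y' hx' hy'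
    obtain ⟨X, hXs, hXD, rfl⟩ :=
      exists_smooth_extension_distD₀ hf hS hchar hW he' hrad he0 hp hx
    obtain ⟨Y, hYs, hYD, rfl⟩ :=
      exists_smooth_extension_distD₀ hf hS hchar hW he' hrad he0 hp hy
    have hφ : ∀ X : Π p : M, TangentSpace I p, (∀ q, X q ∈ distD₀ I s f S q) →
        ∀ q ∈ W, mfderiv I J f q (phiField I s f X q) = s.φ (f q) (mfderiv I J f q (X q)) := by
      intro X hX q hq
      obtain ⟨u, -, hu⟩ := exists_φ_distD₀ hf hS hchar (hrad q hq) (he0 q hq) (hX q)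
      exact mfderiv_pull ⟨u, hu⟩
    have h1 := ha X Y (fun q _ => (hXs q).contMDiffWithinAt) (fun q _ => (hYs q).contMDiffWithinAt)
      (fun q _ => hXD q) (fun q _ => hYD q) p hp
    rw [hB X _ (smoothFieldAt_phiField hf hS hchar hW he' hrad he0 hp (hYs p)
      (hev (fun q hq => ⟨_, hφ Y hYD q hq⟩))), hB _ Y (hYs p)] at h1
    rw [hf.injective_mfderiv p (hx'.trans (hφ X hXD p hp).symm),
      hf.injective_mfderiv p (hy'.trans (hφ Y hYD p hp).symm), h1, hbd, hsymm]
  have pb : ∀ x ∈ distD₀ I s f S p, b x v = 0 := by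
    intro x hx
    obtain ⟨X, hXs, hXD, rfl⟩ :=
      exists_smooth_extension_distD₀ hf hS hchar hW he' hrad he0 hp hx
    have h1 := hb X (fun q _ => (hXs q).contMDiffWithinAt) (fun q _ => hXD q) p hp
    rwa [hB X _ hVs] at h1
  have pc : b v v = 0 := by
    have h1 := hc p hp
    rwa [hB _ _ hVs] at h1
  have hdec : ∀ x ∈ distD I s f S p, ∃ x₀ ∈ distD₀ I s f S p, ∃ a c : ℝ,
      x = x₀ + a • v + c • e p := fun x hx =>
    exists_decomposition hf hS hchar hrp hep hvS hve
      ((mem_distD_iff hf hS hchar hrp hep hvS hve x).1 hx)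
  obtain ⟨x₀, hx₀, a, c, hx⟩ := hdec _ hXD.self_of_nhds
  obtain ⟨y₀, hy₀, a', c', hy⟩ := hdec _ hYD.self_of_nhds
  obtain ⟨x₁, hx₁D, hx₁⟩ := exists_φ_distD₀ hf hS hchar hrp hep hx₀
  obtain ⟨y₁, hy₁D, hy₁⟩ := exists_φ_distD₀ hf hS hchar hrp hep hy₀
  -- On the decomposition, `φ` sends `V` to `E` and `E` to `-V`.
  have hφ : ∀ (x₀ x₁ : TangentSpace I p) (a c : ℝ),
      mfderiv I J f p x₁ = s.φ (f p) (mfderiv I J f p x₀) →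
      mfderiv I J f p (x₁ + a • e p + c • (-v))
        = s.φ (f p) (mfderiv I J f p (x₀ + a • v + c • e p)) := by
    intro x₀ x₁ a c h1
    simp only [map_add, map_smul, map_neg, h1, hve, hchar.φ_φ_radical hrp, neg_neg]
  refine (bracket_mem_distD_iff hr hs h hf hS hchar hW he hrad he0 hp hX hY hXD hYD
    (x := x₁ + a • e p + c • (-v)) (y := y₁ + a' • e p + c' • (-v))
    (by rw [hx, hφ _ _ _ _ hx₁]) (by rw [hy, hφ _ _ _ _ hy₁])).2 ?_
  rw [hx, hy, ← hbd]
  -- Terms containing `E` vanish identically and those containing `V` vanish by b) and c), so only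
  -- the `D₀` parts remain, to which a) applies.
  have hl : ∀ (x₀ y₁ : TangentSpace I p) (a c a' c' : ℝ), x₀ ∈ distD₀ I s f S p →
      y₁ ∈ distD₀ I s f S p →
      b (x₀ + a • v + c • e p) (y₁ + a' • e p + c' • (-v)) = b x₀ y₁ := by
    intro x₀ y₁ a c a' c' hx₀ hy₁
    have ha3 := radForm_radical_left h hf (he' p hp) (hev hrad)
    have ha4 := radForm_radical_right h hf (he' p hp) (hev hrad)
    have hvy : b v y₁ = 0 := by rw [hbd, hsymm]; exact pb y₁ hy₁
    rw [← neg_one_smul ℝ v]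
    simp only [hbd, radForm_add_left, radForm_smul_left, radForm_add_right, radForm_smul_right, ha3, ha4]
    simp only [← hbd, pb x₀ hx₀, pc, hvy]
    ring
  rw [hl _ _ _ _ _ _ hx₀ hy₁D, hl _ _ _ _ _ _ hy₀ hx₁D]
  exact pa x₀ hx₀ y₀ hy₀ x₁ y₁ hx₁ hy₁

end Integrability

end

end LightlikeGeometry

end

theorem mainTheorem7 {k m r : ℕ} (hr : 0 < r)
    {N : Type*} [TopologicalSpace N] [T2Space N] [SigmaCompactSpace N]
    [ChartedSpace (EuclideanSpace ℝ (Fin k)) N] [IsManifold (𝓡 k) ∞ N]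
    {M : Type*} [TopologicalSpace M] [T2Space M] [SigmaCompactSpace M]
    [ChartedSpace (EuclideanSpace ℝ (Fin m)) M] [IsManifold (𝓡 m) ∞ M]
    (s : LightlikeGeometry.IndefiniteMetricGFF (𝓡 k) N r) (hs : s.IsSManifold)
    (nabla : CovariantDerivative (𝓡 k) (EuclideanSpace ℝ (Fin k))
      (TangentSpace (𝓡 k) : N → Type _))
    (hnabla : LightlikeGeometry.IsLeviCivita s.metric nabla)
    (f : M → N) (hf : LightlikeGeometry.IsLightlikeHypersurface (𝓡 m) s.metric f)
    (S : Π p : M, Submodule ℝ (TangentSpace (𝓡 m) p))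
    (hS : LightlikeGeometry.IsScreen (𝓡 m) s.metric f S)
    (hchar : LightlikeGeometry.IsCharacteristic (𝓡 m) s f S)
    {ι : Type*} (U : ι → Set M) (hU : ∀ i, IsOpen (U i)) (hcover : ⋃ i, U i = Set.univ)
    (E : ι → Π p : M, TangentSpace (𝓡 m) p)
    (hE : ∀ i, LightlikeGeometry.IsSmoothFieldOn (𝓡 m) (E i) (U i))
    (hErad : ∀ i, ∀ p ∈ U i, E i p ∈ LightlikeGeometry.radical (𝓡 m) s.metric f p)
    (hE0 : ∀ i, ∀ p ∈ U i, E i p ≠ 0) :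
    LightlikeGeometry.IsIntegrable (𝓡 m) (LightlikeGeometry.distD (𝓡 m) s f S) ↔
      ∀ i,
        let B := LightlikeGeometry.localSecondFundamentalForm (𝓡 m) s.metric nabla f S (E i)
        let φ := LightlikeGeometry.phiField (𝓡 m) s f
        let D₀ := LightlikeGeometry.distD₀ (𝓡 m) s f S
        let V : Π p : M, TangentSpace (𝓡 m) p := fun p => -φ (E i) p
        (∀ X Y : Π p : M, TangentSpace (𝓡 m) p,
          LightlikeGeometry.IsSmoothFieldOn (𝓡 m) X (U i) →
          LightlikeGeometry.IsSmoothFieldOn (𝓡 m) Y (U i) →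
          (∀ p ∈ U i, X p ∈ D₀ p) → (∀ p ∈ U i, Y p ∈ D₀ p) →
          ∀ p ∈ U i, B X (φ Y) p = B (φ X) Y p) ∧
        (∀ X : Π p : M, TangentSpace (𝓡 m) p,
          LightlikeGeometry.IsSmoothFieldOn (𝓡 m) X (U i) → (∀ p ∈ U i, X p ∈ D₀ p) →
          ∀ p ∈ U i, B X V p = 0) ∧
        (∀ p ∈ U i, B V V p = 0) := by
  constructor
  · intro hint i
    exact LightlikeGeometry.IsCharacteristic.second_fundamental_form_of_integrable hr hs hnabla hf hS
      hchar (hU i) (hE i) (hErad i) (hE0 i) hint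
  · intro h W hW X Y hX hY hXD hYD p hp
    -- Membership of the bracket in `D` at `p` is a local question, so one set of the cover
    -- containing `p` suffices.
    obtain ⟨i, hi⟩ := Set.mem_iUnion.1 (hcover ▸ Set.mem_univ p : p ∈ ⋃ i, U i)
    obtain ⟨ha, hb, hc⟩ := h i
    exact LightlikeGeometry.IsCharacteristic.mlieBracket_mem_distD hr hs hnabla hf hS hchar (hU i)
      (hE i) (hErad i) (hE0 i) ha hb hc hi (hX.contMDiffAt (hW.mem_nhds hp))
      (hY.contMDiffAt (hW.mem_nhds hp)) (Filter.mem_of_superset (hW.mem_nhds hp) hXD)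
      (Filter.mem_of_superset (hW.mem_nhds hp) hYD)
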